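/- Let $\mathcal H,\mathcal B$ be separable complex Hilbert spaces. A *Green system* $\{\mathcal H,\mathcal B;A,\Gamma_0,\Gamma_1\}$ consists of densely defined operators $A:\mathcal H\to\mathcal H$, $\Gamma_0,\Gamma_1:\mathcal H\to\mathcal B$ with $\mathrm{Dom}\,\Gamma_k\supseteq\mathrm{Dom}\,A$ and $$(Au,v)_{\mathcal H}-(u,Av)_{\mathcal H}=(\Gamma_0u,\Gamma_1v)_{\mathcal B}-(\Gamma_1u,\Gamma_0v)_{\mathcal B},\qquad u,v\in\mathrm{Dom}\,A.$$ Assume Ryzhov's axioms: (R1) $L_0:=A|_{\mathrm{Ker}\,\Gamma_0\cap\mathrm{Ker}\,\Gamma_1}$ is densely defined, symmetric, positive definite ($(L_0y,y)\ge\varkappa\|y\|^2$ for some $\varkappa>0$), has nonzero defect indexes, and $\overline A=L_0^*$. (R2) $L:=A|_{\mathrm{Ker}\,\Gamma_0}$ is the Friedrichs extension of $L_0$, and $L^{-1}$ is bounded and defined on all of $\mathcal H$. (R3) $\overline{\mathrm{Ker}\,A}=\mathrm{Ker}\,L_0^*$ and $\overline{\Gamma_0\,\mathrm{Ker}\,A}=\mathcal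 B$. Let $\mathcal F_+$ be the set of $f\in C^\infty([0,\infty);\mathcal B)$ that vanish near $t=0$ and take values in $\Gamma_0\,\mathrm{Dom}\,A$. For $f\in\mathcal F_+$ let $u^f$ be the classical solution of $$u_{tt}+Au=0\ (t>0),\qquad u|_{t=0}=u_t|_{t=0}=0,\qquad \Gamma_0u(t)=f(t)\ (t\ge0).$$ For $T>0$ put $\mathcal F^T=L_2([0,T];\mathcal B)$ and let $\mathcal F^T_+\subset\mathcal F^T$ be the set of restrictions to $[0,T]$ of elements of $\mathcal F_+$. The *control operator* $W^T:\mathcal F^T\to\mathcal H$ is $W^Tf=u^f(T)$ with $\mathrm{Dom}\,W^T=\mathcal F^T_+$; its modulus $|W^T|=((W^T)^*\,\overline{W^T})^{1/2}$ is the nonnegative self-adjoint square root in $\mathcal F^T$. The *response operator* $R^T:\mathcal F^T\to\mathcal F^T$ is $(R^Tf)(t)=\Gamma_1u^f(t)$, $0\le t\le T$, defined on those $f\in\mathcal F^T_+$ for which this function belongs to $\mathcal F^T$. The system is *controllable from the boundary at time $T$* if $$\overline{\{\{u^f(T),Au^f(T)\}\mid f\in\mathcal F_+\}}=\overline{\mathrm{graph}\,A}\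 (=\mathrm{graph}\,L_0^*)\quad\text{in }\mathcal H\times\mathcal H .$$ **Statement.** Let $T>0$ and suppose that the system is controllable from the boundary at time $T$. (i) There is a unitary operator $U^T$ from $\overline{\mathrm{Ran}\,|W^T|}\subseteq\mathcal F^T$ onto $\mathcal H$ such that $\overline{W^T}=U^T|W^T|$, and $$\overline{\{\{|W^T|f,\,|W^T|(-f'')\}\mid f\in\mathcal F_+\}}=\mathrm{graph}\,\big((U^T)^*L_0^*U^T\big),$$ where $f$ and $f''$ are restricted to $[0,T]$. (ii) $|W^T|$ determines $L_0^*$ up to unitary equivalence: if two Green systems with the same $\mathcal B$ (and possibly different spaces $\mathcal H$) satisfy the axioms, are controllable at time $T$, and have the same operator $|W^T|$, then their operators $L_0^*$ are unitarily equivalent. (iii) $R^{2T}$ determines $L_0$ up to unitary equivalence: if two Green systems with the same $\mathcal B$ satisfy the axioms, are controllable at time $T$, and have the same response operator $R^{2T}$, then their operators $L_0$ are unitarily equivalent. -/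

import Mathlib

open MeasureTheory Filter Topology
open scoped ContDiff InnerProductSpace LinearPMap

/-! ### Unbounded operators -/

/-- The kernel of a partially defined operator, as a subspace of the ambient space. -/
def LinearPMap.kernel {E F : Type*} [AddCommGroup E] [Module ℂ E] [AddCommGroup F] [Module ℂ F]
    (Q : E →ₗ.[ℂ] F) : Submodule ℂ E :=
  (LinearMap.ker Q.toFun).map Q.domain.subtype

/-- The closure of the range of an operator. -/
def LinearPMap.closedRange {E F : Type*} [AddCommGroup E] [Module ℂ E]
    [NormedAddCommGroup F] [InnerProductSpace ℂ F] (Q : E →ₗ.[ℂ] F) : Submodule ℂ F :=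
  (LinearMap.range Q.toFun).topologicalClosure

/-- Positive definiteness `(Q y, y) ≥ κ ‖y‖²` with a constant `κ > 0`. -/
def LinearPMap.IsPosDef {H : Type*} [NormedAddCommGroup H] [InnerProductSpace ℂ H]
    (Q : H →ₗ.[ℂ] H) : Prop :=
  ∃ κ : ℝ, 0 < κ ∧ ∀ y : Q.domain, κ * ‖(y : H)‖ ^ 2 ≤ (⟪Q y, (y : H)⟫_ℂ).re

/-- Both defect indexes `dim Ker (Q* ∓ i)` of `Q` are nonzero. -/
def LinearPMap.HasNonzeroDefect {H : Type*} [NormedAddCommGroup H] [InnerProductSpace ℂ H]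
    [CompleteSpace H] (Q : H →ₗ.[ℂ] H) : Prop :=
  (∃ y : H, y ≠ 0 ∧ (y, Complex.I • y) ∈ Q†.graph) ∧ (∃ y : H, y ≠ 0 ∧ (y, -(Complex.I • y)) ∈ Q†.graph)

/-- The domain of the closure of the quadratic form `(Q y, y)` of a positive definite symmetric
operator: limits in `H` of sequences of `Dom Q` that are Cauchy in the form norm. -/
def LinearPMap.formDomain {H : Type*} [NormedAddCommGroup H] [InnerProductSpace ℂ H]
    (Q : H →ₗ.[ℂ] H) : Set H :=
  {y | ∃ s : ℕ → Q.domain, Tendsto (fun n => (s n : H)) atTop (𝓝 y) ∧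
    Tendsto (fun p : ℕ × ℕ => ⟪Q (s p.1 - s p.2), ((s p.1 - s p.2 : Q.domain) : H)⟫_ℂ)
      atTop (𝓝 0)}

/-- `L` is the Friedrichs extension of the positive definite symmetric operator `Q`, that is, the
restriction of `Q*` to the vectors of `Dom Q*` that belong to the form domain of `Q`. -/
def LinearPMap.IsFriedrichsExtension {H : Type*} [NormedAddCommGroup H] [InnerProductSpace ℂ H]
    [CompleteSpace H] (Q L : H →ₗ.[ℂ] H) : Prop :=
  ∀ y z : H, (y, z) ∈ L.graph ↔ (y, z) ∈ Q†.graph ∧ y ∈ Q.formDomain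

/-- `S` is the modulus `|W| = (W* W)^{1/2}` of a closable densely defined operator `W`: the
nonnegative self-adjoint operator whose square, with its natural domain, is `W* (closure W)`.
(The adjoints of `W` and of its closure coincide.) -/
def LinearPMap.IsModulus {E H : Type*} [NormedAddCommGroup E] [InnerProductSpace ℂ E]
    [CompleteSpace E] [NormedAddCommGroup H] [InnerProductSpace ℂ H]
    (S : E →ₗ.[ℂ] E) (W : E →ₗ.[ℂ] H) : Prop :=
  IsSelfAdjoint S ∧ (∀ x : S.domain, 0 ≤ (⟪S x, (x : E)⟫_ℂ).re) ∧
    ∀ x z : E, (∃ y : E, (x, y) ∈ S.graph ∧ (y, z) ∈ S.graph) ↔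
      ∃ y : H, (x, y) ∈ W.closure.graph ∧ (y, z) ∈ W†.graph

/-- Unitary equivalence `Q₂ = V Q₁ V*`, with equality of domains. -/
def LinearPMap.UnitarilyEquivalent {H₁ H₂ : Type*}
    [NormedAddCommGroup H₁] [InnerProductSpace ℂ H₁]
    [NormedAddCommGroup H₂] [InnerProductSpace ℂ H₂]
    (Q₁ : H₁ →ₗ.[ℂ] H₁) (Q₂ : H₂ →ₗ.[ℂ] H₂) : Prop :=
  ∃ V : H₁ ≃ₗᵢ[ℂ] H₂, ∀ y z : H₁, (y, z) ∈ Q₁.graph ↔ (V y, V z) ∈ Q₂.graph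

/-! ### Green systems -/

/-- A Green system `{H, B; A, Γ₀, Γ₁}`: densely defined operators `A : H → H`, `Γ₀, Γ₁ : H → B`
with `Dom Γₖ ⊇ Dom A`, connected by the Green formula. -/
structure GreenSystem (H B : Type*) [NormedAddCommGroup H] [InnerProductSpace ℂ H]
    [NormedAddCommGroup B] [InnerProductSpace ℂ B] where
  A : H →ₗ.[ℂ] H
  Γ₀ : H →ₗ.[ℂ] B
  Γ₁ : H →ₗ.[ℂ] B
  dense_domain : Dense (A.domain : Set H)
  domain_le₀ : A.domain ≤ Γ₀.domain
  domain_le₁ : A.domain ≤ Γ₁.domain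
  green : ∀ u v : A.domain, ⟪A u, (v : H)⟫_ℂ - ⟪(u : H), A v⟫_ℂ =
    ⟪Γ₀ ⟨u, domain_le₀ u.2⟩, Γ₁ ⟨v, domain_le₁ v.2⟩⟫_ℂ -
      ⟪Γ₁ ⟨u, domain_le₁ u.2⟩, Γ₀ ⟨v, domain_le₀ v.2⟩⟫_ℂ

/-- The outer space of controls `L₂([0, T]; B)`. -/
noncomputable abbrev ControlSpace (B : Type*) [NormedAddCommGroup B] (T : ℝ) :=
  Lp B 2 ((volume : Measure ℝ).restrict (Set.Icc 0 T))

namespace GreenSystem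

variable {H B : Type*} [NormedAddCommGroup H] [InnerProductSpace ℂ H]
  [NormedAddCommGroup B] [InnerProductSpace ℂ B]

/-- The operator `L = A|_{Ker Γ₀}`. -/
def L (G : GreenSystem H B) : H →ₗ.[ℂ] H := G.A.domRestrict G.Γ₀.kernel

/-- The operator `L₀ = A|_{Ker Γ₀ ∩ Ker Γ₁}`. -/
def L₀ (G : GreenSystem H B) : H →ₗ.[ℂ] H := G.A.domRestrict (G.Γ₀.kernel ⊓ G.Γ₁.kernel)

/-- Ryzhov's axioms. -/
structure IsRyzhov [CompleteSpace H] (G : GreenSystem H B) : Prop where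
  dense_L₀ : Dense (G.L₀.domain : Set H)
  symmetric_L₀ : G.L₀.IsFormalAdjoint G.L₀
  posDef_L₀ : G.L₀.IsPosDef
  defect_L₀ : G.L₀.HasNonzeroDefect
  closable_A : G.A.IsClosable
  closure_A : G.A.closure = G.L₀†
  friedrichs : G.L₀.IsFriedrichsExtension G.L
  /-- `L` has a bounded inverse defined on all of `H`. -/
  inverse_L : ∃ K : H →L[ℂ] H, ∀ y z : H, (y, z) ∈ G.L.graph ↔ y = K z
  closure_kernel_A : closure (G.A.kernel : Set H) = (G.L₀†.kernel : Set H)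
  closure_trace : closure {b : B | ∃ y ∈ G.A.kernel, (y, b) ∈ G.Γ₀.graph} = Set.univ

/-! ### The dynamical system with boundary control -/

/-- The smooth class of controls: `B`-valued `C^∞` functions of `t ≥ 0` with values in `Γ₀ Dom A`
that vanish near `t = 0`. They are extended to `t < 0` by zero. -/
structure IsControl (G : GreenSystem H B) (f : ℝ → B) : Prop where
  smooth : ContDiff ℝ ∞ f
  vanish : ∃ δ : ℝ, 0 < δ ∧ ∀ t : ℝ, t ≤ δ → f t = 0
  mem : ∀ t : ℝ, ∃ y ∈ G.A.domain, (y, f t) ∈ G.Γ₀.graph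

/-- `u` is the classical solution (wave) of the problem `u'' + A u = 0` for `t > 0`,
`u(0) = u'(0) = 0`, `Γ₀ u(t) = f(t)` for `t ≥ 0`. Only the values `u(t)`, `t ≥ 0`, matter. -/
structure IsWave (G : GreenSystem H B) (f : ℝ → B) (u : ℝ → H) : Prop where
  contDiffOn : ContDiffOn ℝ 2 u (Set.Ici 0)
  eqn : ∀ t : ℝ, 0 < t → (u t, -iteratedDerivWithin 2 u (Set.Ici 0) t) ∈ G.A.graph
  init : u 0 = 0
  init' : derivWithin u (Set.Ici 0) 0 = 0
  bdry : ∀ t : ℝ, 0 ≤ t → (u t, f t) ∈ G.Γ₀.graph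

/-- Controllability from the boundary at the time `T`: the pairs `{u^f(T), A u^f(T)}` are dense in
the graph of `A`, the closures being taken in `H × H`. -/
def IsControllable (G : GreenSystem H B) (T : ℝ) : Prop :=
  closure {p : H × H | ∃ f u, G.IsControl f ∧ G.IsWave f u ∧ p.1 = u T ∧ p ∈ G.A.graph} =
    closure (G.A.graph : Set (H × H))

theorem IsControl.add {G : GreenSystem H B} {f g : ℝ → B} (hf : G.IsControl f)
    (hg : G.IsControl g) : G.IsControl (f + g) where
  smooth := hf.smooth.add hg.smooth
  vanish := by
    obtain ⟨a, ha, hfa⟩ := hf.vanish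
    obtain ⟨b, hb, hgb⟩ := hg.vanish
    refine ⟨min a b, lt_min ha hb, fun t ht => ?_⟩
    simp [hfa t (ht.trans (min_le_left _ _)), hgb t (ht.trans (min_le_right _ _))]
  mem t := by
    obtain ⟨y, hy, hy'⟩ := hf.mem t
    obtain ⟨z, hz, hz'⟩ := hg.mem t
    exact ⟨y + z, add_mem hy hz, add_mem hy' hz'⟩

theorem IsControl.smul {G : GreenSystem H B} {f : ℝ → B} (c : ℂ) (hf : G.IsControl f) :
    G.IsControl (c • f) where
  smooth := contDiff_const.smul hf.smooth
  vanish := by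
    obtain ⟨a, ha, hfa⟩ := hf.vanish
    exact ⟨a, ha, fun t ht => by simp [hfa t ht]⟩
  mem t := by
    obtain ⟨y, hy, hy'⟩ := hf.mem t
    exact ⟨c • y, G.A.domain.smul_mem c hy, G.Γ₀.graph.smul_mem c hy'⟩

theorem isControl_zero (G : GreenSystem H B) : G.IsControl 0 where
  smooth := contDiff_const
  vanish := ⟨1, one_pos, fun _ _ => rfl⟩
  mem _ := ⟨0, zero_mem _, G.Γ₀.graph.zero_mem⟩

theorem IsWave.add {G : GreenSystem H B} {f g : ℝ → B} {u v : ℝ → H} (hu : G.IsWave f u)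
    (hv : G.IsWave g v) : G.IsWave (f + g) (u + v) where
  contDiffOn := hu.contDiffOn.add hv.contDiffOn
  eqn t ht := by
    rw [iteratedDerivWithin_add (Set.mem_Ici.2 ht.le) (uniqueDiffOn_Ici 0) (hu.contDiffOn t ht.le)
      (hv.contDiffOn t ht.le), neg_add]
    exact add_mem (hu.eqn t ht) (hv.eqn t ht)
  init := by simp [hu.init, hv.init]
  init' := by
    rw [derivWithin_add (hu.contDiffOn.differentiableOn (by norm_num) 0 Set.self_mem_Ici)
      (hv.contDiffOn.differentiableOn (by norm_num) 0 Set.self_mem_Ici), hu.init', hv.init', add_zero]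
  bdry t ht := add_mem (hu.bdry t ht) (hv.bdry t ht)

theorem IsWave.smul {G : GreenSystem H B} {f : ℝ → B} {u : ℝ → H} (c : ℂ) (hu : G.IsWave f u) :
    G.IsWave (c • f) (c • u) where
  contDiffOn := contDiffOn_const.smul hu.contDiffOn
  eqn t ht := by
    rw [iteratedDerivWithin_const_smul (Set.mem_Ici.2 ht.le) (uniqueDiffOn_Ici 0) c (hu.contDiffOn t ht.le),
      ← smul_neg]
    exact G.A.graph.smul_mem c (hu.eqn t ht)
  init := by simp [hu.init]
  init' := by
    rw [derivWithin_const_smul c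
      (hu.contDiffOn.differentiableOn (by norm_num) 0 Set.self_mem_Ici), hu.init', smul_zero]
  bdry t ht := G.Γ₀.graph.smul_mem c (hu.bdry t ht)

theorem isWave_zero (G : GreenSystem H B) : G.IsWave 0 0 where
  contDiffOn := contDiffOn_const
  eqn t _ := by
    have h : iteratedDerivWithin 2 (0 : ℝ → H) (Set.Ici 0) t = 0 := by
      simp [Pi.zero_def]
    rw [h, neg_zero]
    exact G.A.graph.zero_mem
  init := rfl
  init' := by simp [Pi.zero_def]
  bdry _ _ := G.Γ₀.graph.zero_mem

/-- The graph of the control operator: the pairs of (the class of) a smooth control restricted to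
`[0, T]` and the state `u^f(T)`. -/
noncomputable def controlGraph (G : GreenSystem H B) (T : ℝ) :
    Submodule ℂ (ControlSpace B T × H) where
  carrier := {p | ∃ f u, G.IsControl f ∧ G.IsWave f u ∧
    p.1 =ᵐ[volume.restrict (Set.Icc 0 T)] f ∧ p.2 = u T}
  zero_mem' := ⟨0, 0, G.isControl_zero, G.isWave_zero, Lp.coeFn_zero _ _ _, rfl⟩
  add_mem' := by
    rintro p q ⟨f, u, hf, hu, hpf, hpu⟩ ⟨g, v, hg, hv, hqg, hqv⟩
    exact ⟨f + g, u + v, hf.add hg, hu.add hv, (Lp.coeFn_add _ _).trans (hpf.add hqg),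
      by simp [hpu, hqv]⟩
  smul_mem' := by
    rintro c p ⟨f, u, hf, hu, hpf, hpu⟩
    exact ⟨c • f, c • u, hf.smul c, hu.smul c, (Lp.coeFn_smul _ _).trans (hpf.const_smul c),
      by simp [hpu]⟩

/-- The control operator `W^T : f ↦ u^f(T)`, defined on the smooth controls. -/
noncomputable def controlOperator (G : GreenSystem H B) (T : ℝ) : ControlSpace B T →ₗ.[ℂ] H :=
  (G.controlGraph T).toLinearPMap

/-- The graph of the response operator: the pairs of (the class of) a smooth control restricted to
`[0, T]` and the function `t ↦ Γ₁ u^f(t)` on `[0, T]`. -/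
noncomputable def responseGraph (G : GreenSystem H B) (T : ℝ) :
    Submodule ℂ (ControlSpace B T × ControlSpace B T) where
  carrier := {p | ∃ f u, G.IsControl f ∧ G.IsWave f u ∧
    p.1 =ᵐ[volume.restrict (Set.Icc 0 T)] f ∧
    ∀ᵐ t ∂(volume.restrict (Set.Icc 0 T)), (u t, p.2 t) ∈ G.Γ₁.graph}
  zero_mem' := by
    refine ⟨0, 0, G.isControl_zero, G.isWave_zero, Lp.coeFn_zero _ _ _, ?_⟩
    filter_upwards [Lp.coeFn_zero B 2 ((volume : Measure ℝ).restrict (Set.Icc 0 T))] with t ht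
    have h : ((0 : ControlSpace B T × ControlSpace B T).2 : ℝ → B) t = 0 := ht
    rw [h]
    exact G.Γ₁.graph.zero_mem
  add_mem' := by
    rintro p q ⟨f, u, hf, hu, hpf, hpu⟩ ⟨g, v, hg, hv, hqg, hqv⟩
    refine ⟨f + g, u + v, hf.add hg, hu.add hv, (Lp.coeFn_add _ _).trans (hpf.add hqg), ?_⟩
    filter_upwards [hpu, hqv, Lp.coeFn_add p.2 q.2] with t h₁ h₂ h₃
    rw [Prod.snd_add, h₃]
    exact add_mem h₁ h₂
  smul_mem' := by
    rintro c p ⟨f, u, hf, hu, hpf, hpu⟩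
    refine ⟨c • f, c • u, hf.smul c, hu.smul c, (Lp.coeFn_smul _ _).trans (hpf.const_smul c), ?_⟩
    filter_upwards [hpu, Lp.coeFn_smul c p.2] with t h₁ h₂
    rw [Prod.smul_snd, h₂]
    exact G.Γ₁.graph.smul_mem c h₁

/-- The response operator `R^T : (R^T f)(t) = Γ₁ u^f(t)`, `0 ≤ t ≤ T`, as an operator in
`L₂([0, T]; B)` defined on the smooth controls `f` (those with `R^T f` in `L₂([0, T]; B)`). -/
noncomputable def responseOperator (G : GreenSystem H B) (T : ℝ) :
    ControlSpace B T →ₗ.[ℂ] ControlSpace B T :=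
  (G.responseGraph T).toLinearPMap

end GreenSystem

/-!
Everything is reduced to bounded operators. By Green's formula `Γ₁ L⁻¹` is closed, hence bounded,
and `P = -(Γ₁ L⁻¹)*` extends the map from a boundary value in `Γ₀ Dom A` to the vector of `Ker A`
with that boundary value. Every `y ∈ Dom A` is `P Γ₀ y + L⁻¹ A y`, so with `K = L⁻¹` the wave
problem becomes `K u'' + u = P f` (`GreenSystem.IsRyzhov.exists_isPoissonPair`). The operator `K`
is nonnegative since `L` is a Friedrichs extension. The functions `√k sin (τ / √k)` are continuous
in `k ≥ 0`, so that the continuous functional calculus of `K` provides `L^{-1/2} sin (τ L^{1/2})`.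
With it the problem is solved for all smooth `f` vanishing near `0`, with any values in `B`
(`wave`, `wave_eqn`). Duhamel's formula `K u(T) = ∫₀ᵀ L^{-1/2} sin ((T - s) L^{1/2}) P f(s) ds`
gives uniqueness, causality and closability of the control operator, and `u(T)` depends
continuously on `f''` in `L₂`. Separated controls `φ(t) b`, whose second derivatives are dense in
`L₂`, hence approximate all smooth controls together with their states
(`exists_seq_separatedControls`): every smooth `f` belongs to the domain of the closure of `W^T`
(`GreenSystem.IsPoissonPair.wave_mem_closure`). Controllability turns into the density of the
pairs `(u^f(T), -u^{f''}(T))` in the graph of `L₀*`.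

If `S² = W* W̄`, then von Neumann's theorem on the core `Dom W* W̄` shows that `S` and `W̄` have
the same domain and `‖S φ‖ = ‖W̄ φ‖`. This is the polar decomposition, which carries the pairs
`(S f, -S f'')` to `(u^f(T), -u^{f''}(T))`. The same equality of norms compares two systems with a
common modulus: then `‖u₁^f(T)‖ = ‖u₂^f(T)‖` for all smooth `f`, also where `f` takes values in
`Γ₀ Dom A` for neither system, and `u₁^f(T) ↦ u₂^f(T)` extends to a unitary equivalence of the
operators `L₀*` (`GreenSystem.unitarilyEquivalent_of_norm_wave_eq`).

For the response operator, the same equality of norms follows from Blagoveshchenskii's identity: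
by Green's formula `(∂ₜ² - ∂ₛ²)(u(t), u(s))` is expressed through `f` and `Γ₁ u`, and the Cauchy
data at `t = 0` vanish (`GreenSystem.norm_wave_eq_of_response`). It is applied to separated
controls, for which `Γ₁ u` is continuous, and extended to all smooth controls by density. Finally
`L₀`, and not just its closure, is determined by `L₀*`, as the boundedness of `Γ₁ L⁻¹` makes `L₀`
closed (`GreenSystem.IsPoissonPair.mem_L₀_iff`).
-/

/-! ### Closed relations and their adjoints -/

section OperatorTheory

variable {E F F₁ F₂ : Type*} [NormedAddCommGroup E] [InnerProductSpace ℂ E]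
  [NormedAddCommGroup F] [InnerProductSpace ℂ F]
  [NormedAddCommGroup F₁] [InnerProductSpace ℂ F₁]
  [NormedAddCommGroup F₂] [InnerProductSpace ℂ F₂]

theorem LinearPMap.mem_adjoint_graph_iff [CompleteSpace E] {Q : E →ₗ.[ℂ] F}
    (hQ : Dense (Q.domain : Set E)) {y : F} {z : E} :
    (y, z) ∈ Q†.graph ↔ ∀ a b, (a, b) ∈ Q.graph → ⟪b, y⟫_ℂ = ⟪a, z⟫_ℂ := by
  rw [LinearPMap.adjoint_graph_eq_graph_adjoint hQ, Submodule.mem_adjoint_iff]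
  simp only [sub_eq_zero]

/-- Von Neumann's theorem: `1 + g* g` is onto for a closed linear relation `g`, because the
orthogonal complement of `g` in `E ⊕ F` is the rotated graph of `g*`. -/
theorem Submodule.exists_mem_and_sub_mem_adjoint [CompleteSpace E] [CompleteSpace F]
    {g : Submodule ℂ (E × F)} (hg : IsClosed (g : Set (E × F))) (x : E) :
    ∃ z w, (z, w) ∈ g ∧ (w, x - z) ∈ g.adjoint := by
  let e := WithLp.prodContinuousLinearEquiv 2 ℂ E F
  let g' : Submodule ℂ (WithLp 2 (E × F)) := g.comap (e : WithLp 2 (E × F) →ₗ[ℂ] E × F)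
  have hg' : IsClosed (g' : Set (WithLp 2 (E × F))) := hg.preimage e.continuous
  have : CompleteSpace g' := hg'.completeSpace_coe
  let p : WithLp 2 (E × F) := WithLp.toLp 2 (x, 0)
  have h1 : e (g'.starProjection p) ∈ g := (g'.starProjection_apply_mem p)
  have h2 : p - g'.starProjection p ∈ g'ᗮ := g'.sub_starProjection_mem_orthogonal p
  refine ⟨(e (g'.starProjection p)).1, (e (g'.starProjection p)).2, h1, ?_⟩
  rw [Submodule.mem_adjoint_iff]
  intro a b hab
  have h3 := (Submodule.mem_orthogonal _ _).1 h2 (WithLp.toLp 2 (a, b)) hab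
  rw [WithLp.prod_inner_apply] at h3
  simp only [WithLp.ofLp_sub, Prod.fst_sub, Prod.snd_sub, p, zero_sub, inner_neg_right] at h3
  change ⟪b, (g'.starProjection p).ofLp.2⟫_ℂ - ⟪a, x - (g'.starProjection p).ofLp.1⟫_ℂ = 0
  linear_combination -h3

/-- For a closed graph `g`, the vectors of the domain of `g* g` form a core of `g`. -/
theorem Submodule.subset_closure_core [CompleteSpace E] [CompleteSpace F]
    {g : Submodule ℂ (E × F)} (hg : IsClosed (g : Set (E × F))) (hg0 : ∀ y, (0, y) ∈ g → y = 0) :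
    (g : Set (E × F)) ⊆ closure {p | p ∈ g ∧ ∃ z, (p.2, z) ∈ g.adjoint} := by
  let e := WithLp.prodContinuousLinearEquiv 2 ℂ E F
  let d : Submodule ℂ (WithLp 2 (E × F)) :=
    { carrier := {q | e q ∈ g ∧ ∃ z, ((e q).2, z) ∈ g.adjoint}
      zero_mem' := ⟨by simp, 0, by simp⟩
      add_mem' := by
        rintro a b ⟨ha, z, hz⟩ ⟨hb, w, hw⟩
        exact ⟨by simpa using add_mem ha hb, z + w, by simpa using add_mem hz hw⟩
      smul_mem' := by
        rintro c a ⟨ha, z, hz⟩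
        exact ⟨by simpa using g.smul_mem c ha, c • z, by simpa using g.adjoint.smul_mem c hz⟩ }
  have hdg : ∀ q ∈ d.topologicalClosure, e q ∈ g := by
    have hcl : IsClosed (g.comap (e : WithLp 2 (E × F) →ₗ[ℂ] E × F) : Set (WithLp 2 (E × F))) :=
      hg.preimage e.continuous
    exact fun q hq => d.topologicalClosure_minimal (fun q hq => hq.1) hcl hq
  have : CompleteSpace d.topologicalClosure := d.isClosed_topologicalClosure.completeSpace_coe
  intro p hp
  obtain ⟨p', rfl⟩ := e.surjective p
  -- `r` is the component of a vector of `g` orthogonal to the core; it is shown to be `0`.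
  let r := p' - d.topologicalClosure.starProjection p'
  have hr : e r ∈ g := by
    simp only [r, map_sub]
    exact sub_mem hp (hdg _ (d.topologicalClosure.starProjection_apply_mem p'))
  have hro : r ∈ d.topologicalClosureᗮ := d.topologicalClosure.sub_starProjection_mem_orthogonal p'
  obtain ⟨z, w, hzw, hw⟩ := exists_mem_and_sub_mem_adjoint hg (e r).1
  have h1 := (Submodule.mem_orthogonal _ _).1 hro (WithLp.toLp 2 (z, w))
    (d.le_topologicalClosure ⟨hzw, _, hw⟩)
  rw [WithLp.prod_inner_apply] at h1
  have h2 : ⟪(e r).2, w⟫_ℂ - ⟪(e r).1, (e r).1 - z⟫_ℂ = 0 :=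
    (Submodule.mem_adjoint_iff _ _).1 hw _ _ hr
  change ⟪z, (e r).1⟫_ℂ + ⟪w, (e r).2⟫_ℂ = 0 at h1
  have h3 : ⟪(e r).1, (e r).1⟫_ℂ = 0 := by
    have h1' := congrArg (starRingEnd ℂ) h1
    simp only [map_add, inner_conj_symm, map_zero] at h1'
    rw [inner_sub_right] at h2
    linear_combination h1' - h2
  have h4 : (e r).1 = 0 := inner_self_eq_zero.1 h3
  have h5 : (e r).2 = 0 := hg0 _ (by rw [← h4]; exact hr)
  have h6 : r = 0 := e.injective (by rw [map_zero]; exact Prod.ext h4 h5)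
  have h7 : p' ∈ d.topologicalClosure := by
    rw [sub_eq_zero.1 h6]
    exact d.topologicalClosure.starProjection_apply_mem p'
  exact map_mem_closure e.continuous h7 fun q hq => hq

/-- If `g₁* g₁ = g₂* g₂` for closed graphs, then `g₁` and `g₂` have the same domain, and the values
have equal norms: this is an identity of quadratic forms on the common core. -/
theorem Submodule.exists_norm_eq_of_adjoint_mul_eq [CompleteSpace E] [CompleteSpace F₁]
    [CompleteSpace F₂] {g₁ : Submodule ℂ (E × F₁)} {g₂ : Submodule ℂ (E × F₂)}
    (h₁ : IsClosed (g₁ : Set (E × F₁))) (h₁0 : ∀ y, (0, y) ∈ g₁ → y = 0)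
    (h₂ : IsClosed (g₂ : Set (E × F₂))) (h₂0 : ∀ y, (0, y) ∈ g₂ → y = 0)
    (h : ∀ x z, (∃ y, (x, y) ∈ g₁ ∧ (y, z) ∈ g₁.adjoint) →
      ∃ y, (x, y) ∈ g₂ ∧ (y, z) ∈ g₂.adjoint)
    {x : E} {y : F₁} (hxy : (x, y) ∈ g₁) : ∃ w, (x, w) ∈ g₂ ∧ ‖w‖ = ‖y‖ := by
  have key : ∀ a b, ((a, b) ∈ g₁ ∧ ∃ z, (b, z) ∈ g₁.adjoint) → ∃ c, (a, c) ∈ g₂ ∧ ‖c‖ = ‖b‖ := by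
    rintro a b ⟨hab, z, hz⟩
    obtain ⟨c, hac, hc⟩ := h a z ⟨b, hab, hz⟩
    refine ⟨c, hac, ?_⟩
    have e1 := (Submodule.mem_adjoint_iff _ _).1 hz _ _ hab
    have e2 := (Submodule.mem_adjoint_iff _ _).1 hc _ _ hac
    have e3 : ⟪c, c⟫_ℂ = ⟪b, b⟫_ℂ := by linear_combination e2 - e1
    rw [@norm_eq_sqrt_re_inner ℂ _ _ _ _ c, @norm_eq_sqrt_re_inner ℂ _ _ _ _ b, e3]
  obtain ⟨s, hs, hlim⟩ := mem_closure_iff_seq_limit.1 (subset_closure_core h₁ h₁0 hxy)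
  choose c hc hcn using fun n => key (s n).1 (s n).2 (hs n)
  have hdiff : ∀ n m, ‖c n - c m‖ = ‖(s n).2 - (s m).2‖ := by
    intro n m
    obtain ⟨zn, hzn⟩ := (hs n).2
    obtain ⟨zm, hzm⟩ := (hs m).2
    obtain ⟨c', hc', hcn'⟩ := key ((s n).1 - (s m).1) ((s n).2 - (s m).2)
      ⟨sub_mem (hs n).1 (hs m).1, zn - zm, sub_mem hzn hzm⟩
    have : c' - (c n - c m) = 0 := h₂0 _ (by simpa using sub_mem hc' (sub_mem (hc n) (hc m)))
    rw [← sub_eq_zero.1 this, hcn']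
  have h2 : Tendsto (fun n => (s n).2) atTop (𝓝 y) := (continuous_snd.tendsto _).comp hlim
  have hcau : CauchySeq c := by
    rw [Metric.cauchySeq_iff]
    intro ε hε
    obtain ⟨N, hN⟩ := Metric.cauchySeq_iff.1 h2.cauchySeq ε hε
    refine ⟨N, fun m hm n hn => ?_⟩
    have := hN m hm n hn
    rwa [dist_eq_norm, ← hdiff, ← dist_eq_norm] at this
  obtain ⟨w, hw⟩ := cauchySeq_tendsto_of_complete hcau
  refine ⟨w, h₂.mem_of_tendsto (((continuous_fst.tendsto _).comp hlim).prodMk_nhds hw)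
    (Eventually.of_forall fun n => hc n), ?_⟩
  exact tendsto_nhds_unique hw.norm (by simpa only [hcn] using h2.norm)

/-- A linear relation between `X` and `Y` that preserves norms extends to a unitary operator between
the closures of its two projections. -/
theorem Submodule.exists_unitary_of_norm_eq [CompleteSpace F₁] [CompleteSpace F₂]
    {R : Submodule ℂ (F₁ × F₂)} (hR : ∀ p ∈ R, ‖p.1‖ = ‖p.2‖)
    (hd : Dense (Prod.snd '' (R : Set (F₁ × F₂)))) {M : Submodule ℂ F₁}
    (hM : (M : Set F₁) = closure (Prod.fst '' (R : Set (F₁ × F₂)))) :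
    ∃ U : M ≃ₗᵢ[ℂ] F₂, ∀ p ∈ R, ∃ h : p.1 ∈ M, U ⟨p.1, h⟩ = p.2 := by
  let C := R.topologicalClosure
  have hC : ∀ p ∈ C, ‖p.1‖ = ‖p.2‖ := by
    have hcl : IsClosed {p : F₁ × F₂ | ‖p.1‖ = ‖p.2‖} :=
      isClosed_eq continuous_fst.norm continuous_snd.norm
    exact fun p hp => closure_minimal (fun p hp => hR p hp) hcl hp
  have : CompleteSpace C := R.isClosed_topologicalClosure.completeSpace_coe
  let f : C →ₗᵢ[ℂ] F₁ := ⟨(LinearMap.fst ℂ F₁ F₂).comp C.subtype, fun p => by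
    change ‖p.1.1‖ = ‖p.1‖
    rw [Prod.norm_def, ← hC p.1 p.2, max_self]⟩
  let s : C →ₗᵢ[ℂ] F₂ := ⟨(LinearMap.snd ℂ F₁ F₂).comp C.subtype, fun p => by
    change ‖p.1.2‖ = ‖p.1‖
    rw [Prod.norm_def, hC p.1 p.2, max_self]⟩
  have hfcl : IsClosed (Set.range f) := f.isometry.isClosedEmbedding.isClosed_range
  have hscl : IsClosed (Set.range s) := s.isometry.isClosedEmbedding.isClosed_range
  have hf : LinearMap.range f.toLinearMap = M := by
    apply SetLike.coe_injective
    rw [hM]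
    apply Set.Subset.antisymm
    · rintro _ ⟨p, rfl⟩
      exact map_mem_closure (f := (Prod.fst : F₁ × F₂ → F₁)) continuous_fst p.2
        fun q hq => ⟨q, hq, rfl⟩
    · refine closure_minimal ?_ hfcl
      rintro _ ⟨p, hp, rfl⟩
      exact ⟨⟨p, R.le_topologicalClosure hp⟩, rfl⟩
  have hs : Function.Surjective s := by
    have : Dense (Set.range s) := hd.mono (by
      rintro _ ⟨p, hp, rfl⟩
      exact ⟨⟨p, R.le_topologicalClosure hp⟩, rfl⟩)
    exact Set.range_eq_univ.1 (hscl.closure_eq ▸ this.closure_eq)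
  refine ⟨(f.equivRange.trans (LinearIsometryEquiv.ofEq _ _ hf)).symm.trans
    (LinearIsometryEquiv.ofSurjective s hs), fun p hp => ?_⟩
  have hp' : p.1 ∈ M := by
    rw [← SetLike.mem_coe, hM]
    exact subset_closure ⟨p, hp, rfl⟩
  refine ⟨hp', ?_⟩
  have : (f.equivRange.trans (LinearIsometryEquiv.ofEq _ _ hf)).symm ⟨p.1, hp'⟩ =
      ⟨p, R.le_topologicalClosure hp⟩ := by
    rw [LinearIsometryEquiv.symm_apply_eq]
    rfl
  rw [LinearIsometryEquiv.trans_apply, this]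
  rfl

end OperatorTheory

/-! ### The sine and cosine families of a nonnegative operator with inverse `K` -/

section WaveFamilies

theorem hasDerivAt_of_norm_sub_le_sq {X : Type*} [NormedAddCommGroup X] [NormedSpace ℝ X]
    {f : ℝ → X} {f' : X} {x c : ℝ} (h : ∀ y, ‖f y - f x - (y - x) • f'‖ ≤ c * (y - x) ^ 2) :
    HasDerivAt f f' x := by
  rw [hasDerivAt_iff_isLittleO]
  refine (Asymptotics.IsBigO.of_bound c (Eventually.of_forall fun y => ?_)).trans_isLittleO
    (Asymptotics.isLittleO_pow_sub_sub x one_lt_two)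
  rw [norm_pow, norm_norm, Real.norm_eq_abs, sq_abs]
  exact h y

theorem abs_cos_add_sub_le (a e : ℝ) :
    |Real.cos (a + e) - Real.cos a + e * Real.sin a| ≤ e ^ 2 := by
  have h := Convex.norm_image_sub_le_of_norm_hasDerivWithin_le (s := Set.Icc (-|e|) |e|)
    (f := fun s => Real.cos (a + s) + s * Real.sin a)
    (f' := fun s => -Real.sin (a + s) + Real.sin a) (x := 0) (y := e) (C := |e|)
    (fun s _ => by
      have h1 := (Real.hasDerivAt_cos (a + s)).comp_const_add a s
      have h2 := (hasDerivAt_id s).mul_const (Real.sin a)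
      simpa using (h1.fun_add h2).hasDerivWithinAt)
    (fun s hs => by
      have := Real.abs_sin_sub_sin_le a (a + s)
      rw [Real.norm_eq_abs, neg_add_eq_sub]
      refine this.trans ?_
      rw [sub_add_cancel_left, abs_neg]
      exact abs_le.2 hs)
    (convex_Icc _ _) ⟨by simp, by simp⟩ ⟨neg_abs_le e, le_abs_self e⟩
  simp only [add_zero, zero_mul, sub_zero, Real.norm_eq_abs, abs_mul_abs_self] at h
  rw [add_sub_right_comm, ← pow_two] at h
  exact h

theorem abs_sin_add_sub_le (a e : ℝ) :
    |Real.sin (a + e) - Real.sin a - e * Real.cos a| ≤ e ^ 2 := by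
  have h := abs_cos_add_sub_le (a - Real.pi / 2) e
  rwa [show a - Real.pi / 2 + e = a + e - Real.pi / 2 by ring, Real.cos_sub_pi_div_two,
    Real.cos_sub_pi_div_two, Real.sin_sub_pi_div_two, mul_neg, ← sub_eq_add_neg] at h

theorem continuous_mul_comp_div {b : ℝ → ℝ} (hb : Continuous b) (hb1 : ∀ x, |b x| ≤ 1) (τ : ℝ) :
    Continuous fun r : ℝ => r * b (τ / r) := by
  rw [continuous_iff_continuousAt]
  intro r
  rcases eq_or_ne r 0 with rfl | hr
  · have h0 : Tendsto (fun r : ℝ => r * b (τ / r)) (𝓝 0) (𝓝 0) := by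
      refine squeeze_zero_norm (a := fun r => |r|) (fun r => ?_)
        (by simpa using (continuous_abs.tendsto (0 : ℝ)))
      rw [norm_mul, Real.norm_eq_abs, Real.norm_eq_abs]
      exact mul_le_of_le_one_right (abs_nonneg r) (hb1 _)
    rw [ContinuousAt, zero_mul]
    exact h0
  · exact continuousAt_id.mul (ContinuousAt.comp (f := fun r => τ / r) hb.continuousAt
      (continuousAt_const.div continuousAt_id hr))

variable {H : Type*} [NormedAddCommGroup H] [InnerProductSpace ℂ H] [CompleteSpace H]

/-- `L^{-1/2} sin (τ L^{1/2})` for the inverse `L` of a nonnegative operator `K`. As a function of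
`K` it extends continuously by zero to the point `0` of the spectrum, so that the functional
calculus of the bounded operator `K` applies. -/
noncomputable def sinOp (K : H →L[ℂ] H) (τ : ℝ) : H →L[ℂ] H :=
  cfc (fun k : ℝ => √k * Real.sin (τ / √k)) K

/-- `L^{-1} cos (τ L^{1/2})` for the inverse `L` of a nonnegative operator `K`. -/
noncomputable def cosOp (K : H →L[ℂ] H) (τ : ℝ) : H →L[ℂ] H :=
  cfc (fun k : ℝ => √k * (√k * Real.cos (τ / √k))) K

theorem continuous_sinOp_symbol (τ : ℝ) : Continuous fun k : ℝ => √k * Real.sin (τ / √k) :=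
  (continuous_mul_comp_div Real.continuous_sin Real.abs_sin_le_one τ).comp Real.continuous_sqrt

theorem continuous_cosOp_symbol (τ : ℝ) :
    Continuous fun k : ℝ => √k * (√k * Real.cos (τ / √k)) :=
  Real.continuous_sqrt.mul
    ((continuous_mul_comp_div Real.continuous_cos Real.abs_cos_le_one τ).comp Real.continuous_sqrt)

variable {K : H →L[ℂ] H}

@[simp] theorem sinOp_zero : sinOp K 0 = 0 := by
  simp [sinOp]

theorem cosOp_zero (hK : 0 ≤ K) : cosOp K 0 = K := by
  have hsa : IsSelfAdjoint K := IsSelfAdjoint.of_nonneg hK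
  unfold cosOp
  refine (cfc_congr (g := id) fun k hk => ?_).trans (cfc_id ℝ K)
  have : 0 ≤ k := spectrum_nonneg_of_nonneg hK hk
  simp [Real.mul_self_sqrt this]

theorem sinOp_mul_eq_cfc (hK : 0 ≤ K) (τ : ℝ) :
    sinOp K τ * K = cfc (fun k : ℝ => √k * Real.sin (τ / √k) * k) K := by
  have hsa : IsSelfAdjoint K := IsSelfAdjoint.of_nonneg hK
  rw [cfc_mul _ _ K (continuous_sinOp_symbol τ).continuousOn, cfc_id' ℝ K, sinOp]

theorem sinOp_comm (hK : 0 ≤ K) (τ : ℝ) (x : H) : K (sinOp K τ x) = sinOp K τ (K x) := by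
  have hsa : IsSelfAdjoint K := IsSelfAdjoint.of_nonneg hK
  have h : Commute K (cfc (fun k : ℝ => √k * Real.sin (τ / √k)) K) := by
    have h := cfc_commute_cfc (fun k : ℝ => k) (fun k : ℝ => √k * Real.sin (τ / √k)) K
    rwa [cfc_id' ℝ K] at h
  exact congrArg (fun A : H →L[ℂ] H => A x) h.eq

theorem hasDerivAt_cosOp (hK : 0 ≤ K) (τ : ℝ) : HasDerivAt (cosOp K) (-sinOp K τ) τ := by
  have hsa : IsSelfAdjoint K := IsSelfAdjoint.of_nonneg hK
  refine hasDerivAt_of_norm_sub_le_sq (c := 1) fun t => ?_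
  have hc := fun s => (continuous_cosOp_symbol s).continuousOn (s := spectrum ℝ K)
  have hs := fun s => (continuous_sinOp_symbol s).continuousOn (s := spectrum ℝ K)
  rw [cosOp, cosOp, sinOp, smul_neg, sub_neg_eq_add, ← cfc_sub _ _ K (hc _) (hc _),
    ← cfc_smul (t - τ) _ K (hs _),
    ← cfc_add K (fun k : ℝ => √k * (√k * Real.cos (t / √k)) - √k * (√k * Real.cos (τ / √k)))
      (fun k : ℝ => (t - τ) • (√k * Real.sin (τ / √k)))
      ((hc _).sub (hc _)) ((hs τ).const_smul (t - τ))]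
  refine norm_cfc_le (by positivity) fun k hk => ?_
  rcases eq_or_ne (√k) 0 with h0 | h0
  · simp only [h0, zero_mul, sub_zero, smul_zero, add_zero, norm_zero]
    positivity
  · have h := abs_cos_add_sub_le (τ / √k) ((t - τ) / √k)
    rw [← add_div, add_sub_cancel] at h
    have e : √k * (√k * Real.cos (t / √k)) - √k * (√k * Real.cos (τ / √k)) +
        (t - τ) • (√k * Real.sin (τ / √k)) =
        (√k) ^ 2 * (Real.cos (t / √k) - Real.cos (τ / √k) +
          (t - τ) / √k * Real.sin (τ / √k)) := by
      rw [smul_eq_mul]; field_simp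
    rw [e, norm_mul, Real.norm_eq_abs (_ + _), norm_pow, Real.norm_eq_abs, sq_abs]
    calc (√k) ^ 2 * _ ≤ (√k) ^ 2 * ((t - τ) / √k) ^ 2 := by gcongr
      _ = 1 * (t - τ) ^ 2 := by field_simp

theorem hasDerivAt_sinOp_mul (hK : 0 ≤ K) (τ : ℝ) :
    HasDerivAt (fun s => sinOp K s * K) (cosOp K τ) τ := by
  have hsa : IsSelfAdjoint K := IsSelfAdjoint.of_nonneg hK
  refine hasDerivAt_of_norm_sub_le_sq (c := √(‖K‖ * ‖(1 : H →L[ℂ] H)‖)) fun t => ?_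
  have hc := fun s => (continuous_cosOp_symbol s).continuousOn (s := spectrum ℝ K)
  have hs : ∀ s, ContinuousOn (fun k : ℝ => √k * Real.sin (s / √k) * k) (spectrum ℝ K) :=
    fun s => ((continuous_sinOp_symbol s).mul continuous_id).continuousOn
  rw [sinOp_mul_eq_cfc hK, sinOp_mul_eq_cfc hK, cosOp, ← cfc_sub _ _ K (hs _) (hs _),
    ← cfc_smul (t - τ) _ K (hc _),
    ← cfc_sub (fun k : ℝ => √k * Real.sin (t / √k) * k - √k * Real.sin (τ / √k) * k)
      (fun k : ℝ => (t - τ) • (√k * (√k * Real.cos (τ / √k)))) K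
      ((hs _).sub (hs _)) ((hc τ).const_smul (t - τ))]
  refine norm_cfc_le (by positivity) fun k hk => ?_
  have hk0 : 0 ≤ k := spectrum_nonneg_of_nonneg hK hk
  have hkle : √k ≤ √(‖K‖ * ‖(1 : H →L[ℂ] H)‖) := by
    refine Real.sqrt_le_sqrt ((le_abs_self k).trans ?_)
    exact spectrum.norm_le_norm_mul_of_mem hk
  rcases eq_or_ne (√k) 0 with h0 | h0
  · simp only [h0, zero_mul, sub_zero, smul_zero, norm_zero]
    positivity
  · have h := abs_sin_add_sub_le (τ / √k) ((t - τ) / √k)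
    rw [← add_div, add_sub_cancel] at h
    have e : √k * Real.sin (t / √k) * k - √k * Real.sin (τ / √k) * k -
        (t - τ) • (√k * (√k * Real.cos (τ / √k))) =
        (√k) ^ 3 * (Real.sin (t / √k) - Real.sin (τ / √k) -
          (t - τ) / √k * Real.cos (τ / √k)) := by
      have hk2 : k = √k * √k := (Real.mul_self_sqrt hk0).symm
      generalize √k = r at *
      subst hk2
      rw [smul_eq_mul]; field_simp
    rw [e, norm_mul, Real.norm_eq_abs (_ - _), norm_pow, Real.norm_eq_abs,
      abs_of_nonneg (Real.sqrt_nonneg k)]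
    calc (√k) ^ 3 * _ ≤ (√k) ^ 3 * ((t - τ) / √k) ^ 2 := by gcongr
      _ = √k * (t - τ) ^ 2 := by field_simp
      _ ≤ _ := by gcongr

theorem continuous_sinOp (hK : 0 ≤ K) : Continuous (sinOp K) := by
  have hsa : IsSelfAdjoint K := IsSelfAdjoint.of_nonneg hK
  have hs := fun s => (continuous_sinOp_symbol s).continuousOn (s := spectrum ℝ K)
  refine (LipschitzWith.of_dist_le_mul (K := 1) fun t τ => ?_).continuous
  rw [dist_eq_norm, sinOp, sinOp, ← cfc_sub _ _ K (hs _) (hs _)]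
  refine norm_cfc_le (by positivity) fun k hk => ?_
  rw [Real.dist_eq, ← mul_sub, norm_mul, Real.norm_eq_abs (_ - _), NNReal.coe_one, one_mul,
    Real.norm_eq_abs, abs_of_nonneg (Real.sqrt_nonneg k)]
  rcases eq_or_ne (√k) 0 with h0 | h0
  · simp [h0]
  · calc √k * _ ≤ √k * |t / √k - τ / √k| := by
          exact mul_le_mul_of_nonneg_left (Real.abs_sin_sub_sin_le _ _) (Real.sqrt_nonneg k)
      _ = |t - τ| := by
          rw [← sub_div, abs_div, abs_of_nonneg (Real.sqrt_nonneg k)]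
          field_simp

end WaveFamilies

/-! ### Duhamel's principle -/

section Duhamel

variable {X Y : Type*} [NormedAddCommGroup X] [NormedSpace ℂ X] [NormedAddCommGroup Y]
  [NormedSpace ℂ Y]

/-- The product rule for the application of complex-linear operators, differentiated with respect
to a real variable. -/
theorem HasDerivWithinAt.clm_apply_complex {A : ℝ → X →L[ℂ] Y} {A' : X →L[ℂ] Y} {v : ℝ → X} {v' : X}
    {s : Set ℝ} {t : ℝ} (hA : HasDerivWithinAt A A' s t) (hv : HasDerivWithinAt v v' s t) :
    HasDerivWithinAt (fun t => A t (v t)) (A' (v t) + A t v') s t :=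
  ((ContinuousLinearMap.restrictScalarsL ℂ X Y ℝ ℝ).hasFDerivAt.comp_hasDerivWithinAt t
    hA).clm_apply hv

theorem HasDerivAt.clm_comp_complex (A : X →L[ℂ] Y) {v : ℝ → X} {v' : X} {t : ℝ}
    (hv : HasDerivAt v v' t) : HasDerivAt (fun t => A (v t)) (A v') t :=
  (A.restrictScalars ℝ).hasFDerivAt.comp_hasDerivAt t hv

variable {H : Type*} [NormedAddCommGroup H] [InnerProductSpace ℂ H] [CompleteSpace H]
  {K : H →L[ℂ] H}

/-- Duhamel's integral `∫₀ᵗ L^{-1/2} sin ((t - s) L^{1/2}) p(s) ds`, where `K = L⁻¹`. -/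
noncomputable def duhamel (K : H →L[ℂ] H) (p : ℝ → H) (t : ℝ) : H :=
  ∫ s in (0 : ℝ)..t, sinOp K (t - s) (p s)

/-- Duhamel's principle for `K v'' + v = p`, `v(0) = v'(0) = 0`. -/
theorem duhamel_eq (hK : 0 ≤ K) {v v₁ v₂ : ℝ → H}
    (hv : ∀ t, 0 ≤ t → HasDerivWithinAt v (v₁ t) (Set.Ici 0) t)
    (hv₁ : ∀ t, 0 ≤ t → HasDerivWithinAt v₁ (v₂ t) (Set.Ici 0) t)
    (hv₂ : ContinuousOn v₂ (Set.Ici 0)) (h0 : v 0 = 0) (h1 : v₁ 0 = 0) {t : ℝ} (ht : 0 ≤ t) :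
    duhamel K (fun s => K (v₂ s) + v s) t = K (v t) := by
  have hS : ∀ s, HasDerivAt (fun s => sinOp K (t - s) * K) (-cosOp K (t - s)) s := fun s =>
    (hasDerivAt_sinOp_mul hK (t - s)).comp_const_sub t s
  have hC : ∀ s, HasDerivAt (fun s => cosOp K (t - s)) (sinOp K (t - s)) s := fun s => by
    simpa using (hasDerivAt_cosOp hK (t - s)).comp_const_sub t s
  -- A primitive of the integrand. It contains `sinOp * K` because `sinOp` itself need not be
  -- differentiable in the operator norm.
  have hΦ : ∀ s, 0 ≤ s → HasDerivWithinAt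
      (fun s => (sinOp K (t - s) * K) (v₁ s) + cosOp K (t - s) (v s))
      (sinOp K (t - s) (K (v₂ s) + v s)) (Set.Ici 0) s := fun s hs => by
    have := ((hS s).hasDerivWithinAt.clm_apply_complex (hv₁ s hs)).fun_add
      ((hC s).hasDerivWithinAt.clm_apply_complex (hv s hs))
    convert this using 1
    have e : (sinOp K (t - s) * K) (v₂ s) = sinOp K (t - s) (K (v₂ s)) := rfl
    rw [map_add, neg_apply, e]
    abel
  have hcs : Continuous fun s => sinOp K (t - s) := (continuous_sinOp hK).comp (by fun_prop)
  have hsub : Set.Icc 0 t ⊆ Set.Ici 0 := Set.Icc_subset_Ici_self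
  have hcv : ContinuousOn v (Set.Ici 0) := fun s hs => (hv s hs).continuousWithinAt
  have := intervalIntegral.integral_eq_sub_of_hasDeriv_right_of_le ht
    (fun s hs => ((hΦ s hs.1).continuousWithinAt).mono hsub)
    (fun s hs => ((hΦ s hs.1.le).hasDerivAt (Ici_mem_nhds hs.1)).hasDerivWithinAt)
    (ContinuousOn.intervalIntegrable (by
      rw [Set.uIcc_of_le ht]
      exact hcs.continuousOn.clm_apply
        ((K.continuous.comp_continuousOn (hv₂.mono hsub)).add (hcv.mono hsub))))
  rw [duhamel, this]
  simp [h0, h1, cosOp_zero hK]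

end Duhamel

/-! ### Smooth controls -/

section SmoothControls

variable {X Y : Type*} [NormedAddCommGroup X] [NormedSpace ℂ X] [NormedAddCommGroup Y]
  [NormedSpace ℂ Y]

/-- Smooth functions that vanish for `t ≤ δ` with some `δ > 0`, with arbitrary values in `X`. -/
structure IsSmoothControl (f : ℝ → X) : Prop where
  smooth : ContDiff ℝ ∞ f
  vanish : ∃ δ : ℝ, 0 < δ ∧ ∀ t : ℝ, t ≤ δ → f t = 0

namespace IsSmoothControl

variable {f g : ℝ → X}

theorem eq_zero (hf : IsSmoothControl f) {t : ℝ} (ht : t ≤ 0) : f t = 0 := by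
  obtain ⟨δ, hδ, h⟩ := hf.vanish
  exact h t (ht.trans hδ.le)

theorem continuous (hf : IsSmoothControl f) : Continuous f := hf.smooth.continuous

theorem hasDerivAt (hf : IsSmoothControl f) (t : ℝ) : HasDerivAt f (deriv f t) t :=
  (hf.smooth.differentiable (by simp) t).hasDerivAt

protected theorem deriv (hf : IsSmoothControl f) : IsSmoothControl (deriv f) where
  smooth := (contDiff_infty_iff_deriv.1 hf.smooth).2
  vanish := by
    obtain ⟨δ, hδ, h⟩ := hf.vanish
    refine ⟨δ / 2, by positivity, fun t ht => ?_⟩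
    have : f =ᶠ[𝓝 t] fun _ => 0 := by
      filter_upwards [Iio_mem_nhds (show t < δ by linarith)] with s hs using h s (le_of_lt hs)
    rw [this.deriv_eq, deriv_const]

theorem clm_comp (A : X →L[ℂ] Y) (hf : IsSmoothControl f) : IsSmoothControl fun t => A (f t) where
  smooth := (A.restrictScalars ℝ).contDiff.comp hf.smooth
  vanish := by
    obtain ⟨δ, hδ, h⟩ := hf.vanish
    exact ⟨δ, hδ, fun t ht => by rw [h t ht, map_zero]⟩

theorem deriv_clm_comp (A : X →L[ℂ] Y) (hf : IsSmoothControl f) :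
    deriv (fun t => A (f t)) = fun t => A (deriv f t) :=
  funext fun t => (HasDerivAt.clm_comp_complex A (hf.hasDerivAt t)).deriv

theorem zero : IsSmoothControl (0 : ℝ → X) where
  smooth := contDiff_const
  vanish := ⟨1, one_pos, fun _ _ => rfl⟩

theorem add (hf : IsSmoothControl f) (hg : IsSmoothControl g) : IsSmoothControl (f + g) where
  smooth := hf.smooth.add hg.smooth
  vanish := by
    obtain ⟨a, ha, hfa⟩ := hf.vanish
    obtain ⟨b, hb, hgb⟩ := hg.vanish
    refine ⟨min a b, lt_min ha hb, fun t ht => ?_⟩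
    simp [hfa t (ht.trans (min_le_left _ _)), hgb t (ht.trans (min_le_right _ _))]

theorem smul (c : ℂ) (hf : IsSmoothControl f) : IsSmoothControl (c • f) where
  smooth := contDiff_const.smul hf.smooth
  vanish := by
    obtain ⟨a, ha, hfa⟩ := hf.vanish
    exact ⟨a, ha, fun t ht => by simp [hfa t ht]⟩

theorem deriv_add (hf : IsSmoothControl f) (hg : IsSmoothControl g) :
    deriv (f + g) = deriv f + deriv g :=
  funext fun t => ((hf.hasDerivAt t).add (hg.hasDerivAt t)).deriv

theorem deriv_smul (c : ℂ) (hf : IsSmoothControl f) : deriv (c • f) = c • deriv f :=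
  funext fun t => ((hf.hasDerivAt t).const_smul c).deriv

/-- The antiderivative `∫₀ᵗ f`. -/
theorem integral [CompleteSpace X] (hf : IsSmoothControl f) :
    IsSmoothControl (fun t => ∫ s in (0 : ℝ)..t, f s) ∧
      deriv (fun t => ∫ s in (0 : ℝ)..t, f s) = f := by
  have hd : ∀ t, HasDerivAt (fun t => ∫ s in (0 : ℝ)..t, f s) (f t) t := fun t =>
    intervalIntegral.integral_hasDerivAt_right (hf.continuous.intervalIntegrable _ _)
      (hf.continuous.stronglyMeasurableAtFilter _ _) hf.continuous.continuousAt
  have hd' : deriv (fun t => ∫ s in (0 : ℝ)..t, f s) = f := funext fun t => (hd t).deriv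
  refine ⟨⟨contDiff_infty_iff_deriv.2 ⟨fun t => (hd t).differentiableAt,
    by rw [hd']; exact hf.smooth⟩, ?_⟩, hd'⟩
  obtain ⟨δ, hδ, h⟩ := hf.vanish
  refine ⟨δ, hδ, fun t ht => ?_⟩
  rw [intervalIntegral.integral_congr (g := fun _ => (0 : X)), intervalIntegral.integral_zero]
  intro s hs
  exact h s (hs.2.trans (max_le hδ.le ht))

/-- Taylor's formula with integral remainder, for vanishing initial data. -/
theorem integral_sub_smul_deriv_deriv [CompleteSpace X] (hf : IsSmoothControl f) (t : ℝ) :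
    ∫ s in (0 : ℝ)..t, (t - s) • deriv (deriv f) s = f t := by
  have hd : ∀ s, HasDerivAt (fun s => (t - s) • deriv f s + f s)
      ((t - s) • deriv (deriv f) s) s := by
    intro s
    have := (((hasDerivAt_id s).const_sub t).smul (hf.deriv.hasDerivAt s)).fun_add (hf.hasDerivAt s)
    simpa using this
  rw [intervalIntegral.integral_eq_sub_of_hasDerivAt (fun s _ => hd s)
    (((continuous_const.sub continuous_id).smul hf.deriv.deriv.continuous).intervalIntegrable _ _)]
  simp [hf.eq_zero le_rfl, hf.deriv.eq_zero le_rfl]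

end IsSmoothControl

end SmoothControls

/-! ### Solutions of `K u'' + u = P f` -/

section Waves

variable {H : Type*} [NormedAddCommGroup H] [InnerProductSpace ℂ H] [CompleteSpace H]
  {B : Type*} [NormedAddCommGroup B] [InnerProductSpace ℂ B]
  {K : H →L[ℂ] H} {P : B →L[ℂ] H}

theorem duhamel_eq_integral {p : ℝ → H} (hp : IsSmoothControl p) {t M : ℝ} (htM : t ≤ M)
    (hK : 0 ≤ K) : duhamel K p t = ∫ r in (0 : ℝ)..M, sinOp K r (p (t - r)) := by
  have hc : Continuous fun r => sinOp K r (p (t - r)) :=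
    (continuous_sinOp hK).clm_apply (hp.continuous.comp (by fun_prop))
  have h1 := intervalIntegral.integral_comp_sub_left (a := 0) (b := t)
    (fun r => sinOp K r (p (t - r))) t
  simp only [sub_sub_cancel, sub_self, sub_zero] at h1
  have h2 : ∫ r in t..M, sinOp K r (p (t - r)) = 0 := by
    rw [intervalIntegral.integral_congr (g := fun _ => (0 : H)), intervalIntegral.integral_zero]
    intro r hr
    rw [Set.uIcc_of_le htM] at hr
    simp [hp.eq_zero (sub_nonpos.2 hr.1)]
  rw [duhamel, h1, ← intervalIntegral.integral_add_adjacent_intervals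
    (hc.intervalIntegrable 0 t) (hc.intervalIntegrable t M), h2, add_zero]

theorem hasDerivAt_duhamel (hK : 0 ≤ K) {p : ℝ → H} (hp : IsSmoothControl p) (t : ℝ) :
    HasDerivAt (duhamel K p) (duhamel K (deriv p) t) t := by
  have hcF : ∀ x, Continuous fun r => sinOp K r (p (x - r)) := fun x =>
    (continuous_sinOp hK).clm_apply (hp.continuous.comp (by fun_prop))
  have hcF' : Continuous fun q : ℝ × ℝ => sinOp K q.2 (deriv p (q.1 - q.2)) :=
    ((continuous_sinOp hK).comp continuous_snd).clm_apply
      (hp.deriv.continuous.comp (by fun_prop))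
  obtain ⟨C, hC⟩ := ((isCompact_closedBall t (1 : ℝ)).prod
    (isCompact_uIcc (a := (0 : ℝ)) (b := t + 1))).exists_bound_of_continuousOn hcF'.continuousOn
  -- For `x` near `t` the interval of integration is fixed to `[0, t + 1]`, as `p` vanishes on
  -- the negative half-line.
  have key := intervalIntegral.hasDerivAt_integral_of_dominated_loc_of_deriv_le
    (F := fun x r => sinOp K r (p (x - r))) (F' := fun x r => sinOp K r (deriv p (x - r)))
    (x₀ := t) (a := 0) (b := t + 1) (μ := volume) (bound := fun _ => C)
    (Metric.closedBall_mem_nhds t one_pos)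
    (Eventually.of_forall fun x => (hcF x).aestronglyMeasurable)
    ((hcF t).intervalIntegrable _ _)
    (hcF'.comp (by fun_prop : Continuous fun r : ℝ => (t, r))).aestronglyMeasurable
    (Eventually.of_forall fun r hr x hx => hC (x, r) ⟨hx, Set.uIoc_subset_uIcc hr⟩)
    intervalIntegrable_const
    (Eventually.of_forall fun r _ x _ => HasDerivAt.clm_comp_complex _
      ((hp.hasDerivAt (x - r)).comp_sub_const x r))
  rw [duhamel_eq_integral hp.deriv (show t ≤ t + 1 by linarith) hK]
  refine key.2.congr_of_eventuallyEq ?_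
  filter_upwards [Iio_mem_nhds (show t < t + 1 by linarith)] with x hx
  exact duhamel_eq_integral hp (le_of_lt hx) hK

/-- The solution `u = P f - ∫₀ᵗ L^{-1/2} sin ((t - s) L^{1/2}) P f''(s) ds` of the equation
`K u'' + u = P f`, `u(0) = u'(0) = 0`. It makes sense for all smooth controls `f`. -/
noncomputable def wave (K : H →L[ℂ] H) (P : B →L[ℂ] H) (f : ℝ → B) (t : ℝ) : H :=
  P (f t) - duhamel K (fun s => P (deriv (deriv f) s)) t

theorem hasDerivAt_wave (hK : 0 ≤ K) {f : ℝ → B} (hf : IsSmoothControl f) (t : ℝ) :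
    HasDerivAt (wave K P f) (wave K P (deriv f) t) t := by
  have := (HasDerivAt.clm_comp_complex P (hf.hasDerivAt t)).fun_sub
    (hasDerivAt_duhamel hK (hf.deriv.deriv.clm_comp P) t)
  rw [hf.deriv.deriv.deriv_clm_comp P] at this
  exact this

theorem continuous_wave (hK : 0 ≤ K) {f : ℝ → B} (hf : IsSmoothControl f) :
    Continuous (wave K P f) :=
  continuous_iff_continuousAt.2 fun t => (hasDerivAt_wave hK hf t).continuousAt

theorem deriv_wave (hK : 0 ≤ K) {f : ℝ → B} (hf : IsSmoothControl f) :
    deriv (wave K P f) = wave K P (deriv f) :=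
  funext fun t => (hasDerivAt_wave hK hf t).deriv

theorem contDiff_wave (hK : 0 ≤ K) (n : ℕ) {f : ℝ → B} (hf : IsSmoothControl f) :
    ContDiff ℝ n (wave K P f) := by
  induction n generalizing f with
  | zero => exact contDiff_zero.2 (continuous_wave hK hf)
  | succ n ih =>
    rw [Nat.cast_succ, contDiff_succ_iff_deriv, deriv_wave hK hf]
    exact ⟨fun t => (hasDerivAt_wave hK hf t).differentiableAt, by simp, ih hf.deriv⟩

@[simp] theorem wave_zero {f : ℝ → B} (hf : IsSmoothControl f) : wave K P f 0 = 0 := by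
  simp [wave, duhamel, hf.eq_zero le_rfl]

theorem wave_eqn (hK : 0 ≤ K) {f : ℝ → B} (hf : IsSmoothControl f) {t : ℝ} (ht : 0 ≤ t) :
    K (wave K P (deriv (deriv f)) t) + wave K P f t = P (f t) := by
  have hs : Continuous fun s => sinOp K (t - s) := (continuous_sinOp hK).comp (by fun_prop)
  have hg := hf.deriv.deriv
  set g := deriv (deriv f)
  have hPg := hg.clm_comp P
  have hPg1 := hg.deriv.clm_comp P
  have hPg2 := hg.deriv.deriv.clm_comp P
  have h := duhamel_eq hK (v := fun s => P (g s)) (v₁ := fun s => P (deriv g s))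
    (v₂ := fun s => P (deriv (deriv g) s))
    (fun s _ => (HasDerivAt.clm_comp_complex P (hg.hasDerivAt s)).hasDerivWithinAt)
    (fun s _ => (HasDerivAt.clm_comp_complex P (hg.deriv.hasDerivAt s)).hasDerivWithinAt)
    hPg2.continuous.continuousOn (hPg.eq_zero le_rfl) (hPg1.eq_zero le_rfl) ht
  have h1 : duhamel K (fun s => K (P (deriv (deriv g) s)) + P (g s)) t =
      K (duhamel K (fun s => P (deriv (deriv g) s)) t) + duhamel K (fun s => P (g s)) t := by
    have hi₁ : Continuous fun s => K (sinOp K (t - s) (P (deriv (deriv g) s))) :=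
      K.continuous.comp (hs.clm_apply hPg2.continuous)
    have hi₂ : Continuous fun s => sinOp K (t - s) (P (g s)) := hs.clm_apply hPg.continuous
    unfold duhamel
    rw [← ContinuousLinearMap.intervalIntegral_comp_comm K
        ((hs.clm_apply hPg2.continuous).intervalIntegrable _ _),
      ← intervalIntegral.integral_add (hi₁.intervalIntegrable _ _) (hi₂.intervalIntegrable _ _)]
    refine intervalIntegral.integral_congr fun s _ => ?_
    simp only [map_add, sinOp_comm hK]
  rw [h1] at h
  simp only [wave, map_sub]
  rw [← h]
  simp only [g]
  abel

/-- Two solutions of `K v'' + v = P f` with zero initial data are equal after an application of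
`K`, both being given by Duhamel's integral. -/
theorem map_eq_duhamel (hK : 0 ≤ K) {f : ℝ → B} {v v₁ v₂ : ℝ → H}
    (hv : ∀ t, 0 ≤ t → HasDerivWithinAt v (v₁ t) (Set.Ici 0) t)
    (hv₁ : ∀ t, 0 ≤ t → HasDerivWithinAt v₁ (v₂ t) (Set.Ici 0) t)
    (hv₂ : ContinuousOn v₂ (Set.Ici 0)) (h0 : v 0 = 0) (h1 : v₁ 0 = 0)
    (heq : ∀ t, 0 < t → K (v₂ t) + v t = P (f t)) {t : ℝ} (ht : 0 ≤ t) :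
    K (v t) = duhamel K (fun s => P (f s)) t := by
  rw [← duhamel_eq hK hv hv₁ hv₂ h0 h1 ht]
  refine intervalIntegral.integral_congr_ae (Eventually.of_forall fun s hs => ?_)
  rw [Set.uIoc_of_le ht] at hs
  simp only [heq s hs.1]

theorem map_wave (hK : 0 ≤ K) {f : ℝ → B} (hf : IsSmoothControl f) {t : ℝ} (ht : 0 ≤ t) :
    K (wave K P f t) = duhamel K (fun s => P (f s)) t :=
  map_eq_duhamel hK (fun t _ => (hasDerivAt_wave hK hf t).hasDerivWithinAt)
    (fun t _ => (hasDerivAt_wave hK hf.deriv t).hasDerivWithinAt)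
    (continuous_wave hK hf.deriv.deriv).continuousOn (wave_zero hf) (wave_zero hf.deriv)
    (fun _ ht => wave_eqn hK hf ht.le) ht

theorem wave_add (hK : 0 ≤ K) {f g : ℝ → B} (hf : IsSmoothControl f) (hg : IsSmoothControl g)
    (t : ℝ) : wave K P (f + g) t = wave K P f t + wave K P g t := by
  have hs : Continuous fun s => sinOp K (t - s) := (continuous_sinOp hK).comp (by fun_prop)
  simp only [wave, duhamel, hf.deriv_add hg, hf.deriv.deriv_add hg.deriv, Pi.add_apply, map_add]
  rw [intervalIntegral.integral_add
    ((hs.clm_apply (hf.deriv.deriv.clm_comp P).continuous).intervalIntegrable _ _)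
    ((hs.clm_apply (hg.deriv.deriv.clm_comp P).continuous).intervalIntegrable _ _)]
  abel

theorem wave_smul (c : ℂ) {f : ℝ → B} (hf : IsSmoothControl f) (t : ℝ) :
    wave K P (c • f) t = c • wave K P f t := by
  simp only [wave, duhamel, hf.deriv_smul c, hf.deriv.deriv_smul c, Pi.smul_apply, map_smul,
    intervalIntegral.integral_smul, smul_sub]

end Waves

/-! ### Controls as elements of `L₂([0, T]; B)` -/

section ControlSpace

variable {B : Type*} [NormedAddCommGroup B]

theorem Continuous.memLp_restrict_Icc {f : ℝ → B} (hf : Continuous f) (T : ℝ) :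
    MemLp f 2 (volume.restrict (Set.Icc 0 T)) := by
  obtain ⟨C, hC⟩ := (isCompact_Icc (a := (0 : ℝ)) (b := T)).exists_bound_of_continuousOn
    hf.continuousOn
  exact MemLp.of_bound hf.aestronglyMeasurable C
    ((ae_restrict_iff' measurableSet_Icc).2 (Eventually.of_forall hC))

open scoped Classical in
/-- The class in `L₂([0, T]; B)` of the restriction of `f` to `[0, T]`, with the value `0` if `f` is
not square integrable. -/
noncomputable def toControl (T : ℝ) (f : ℝ → B) : ControlSpace B T :=
  if h : MemLp f 2 (volume.restrict (Set.Icc 0 T)) then h.toLp f else 0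

theorem coeFn_toControl (T : ℝ) {f : ℝ → B} (hf : Continuous f) :
    toControl T f =ᵐ[volume.restrict (Set.Icc 0 T)] f := by
  rw [toControl, dif_pos (hf.memLp_restrict_Icc T)]
  exact MemLp.coeFn_toLp _

theorem eq_toControl {T : ℝ} {f : ℝ → B} (hf : Continuous f) {φ : ControlSpace B T} :
    φ =ᵐ[volume.restrict (Set.Icc 0 T)] f ↔ φ = toControl T f :=
  ⟨fun h => Lp.ext (h.trans (coeFn_toControl T hf).symm), fun h => h ▸ coeFn_toControl T hf⟩

theorem toControl_add (T : ℝ) {f g : ℝ → B} (hf : Continuous f) (hg : Continuous g) :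
    toControl T (f + g) = toControl T f + toControl T g :=
  ((eq_toControl (hf.add hg)).1 ((Lp.coeFn_add _ _).trans
    ((coeFn_toControl T hf).add (coeFn_toControl T hg)))).symm

theorem toControl_sub (T : ℝ) {f g : ℝ → B} (hf : Continuous f) (hg : Continuous g) :
    toControl T (f - g) = toControl T f - toControl T g :=
  ((eq_toControl (hf.sub hg)).1 ((Lp.coeFn_sub _ _).trans
    ((coeFn_toControl T hf).sub (coeFn_toControl T hg)))).symm

theorem exists_integral_norm_le (T : ℝ) : ∃ C : ℝ, 0 ≤ C ∧ ∀ φ : ControlSpace B T,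
    ∫ t in Set.Icc 0 T, ‖φ t‖ ≤ C * ‖φ‖ := by
  refine ⟨((volume.restrict (Set.Icc 0 T)) Set.univ ^ (1 / 2 : ℝ)).toReal, ENNReal.toReal_nonneg,
    fun φ => ?_⟩
  have h := eLpNorm_le_eLpNorm_mul_rpow_measure_univ (p := 1) (q := 2) (by norm_num)
    (Lp.aestronglyMeasurable φ)
  rw [integral_norm_eq_lintegral_enorm (Lp.aestronglyMeasurable φ),
    ← eLpNorm_one_eq_lintegral_enorm, Lp.norm_def, mul_comm, ← ENNReal.toReal_mul]
  refine ENNReal.toReal_mono (ENNReal.mul_ne_top (Lp.eLpNorm_ne_top φ) ?_) ?_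
  · exact ENNReal.rpow_ne_top_of_nonneg (by norm_num) (measure_ne_top _ _)
  · convert h using 3
    norm_num

theorem integrable_coeFn {T : ℝ} (φ : ControlSpace B T) :
    Integrable φ (volume.restrict (Set.Icc 0 T)) :=
  (Lp.memLp φ).integrable one_le_two

variable [InnerProductSpace ℂ B]

theorem toControl_smul (T : ℝ) (c : ℂ) {f : ℝ → B} (hf : Continuous f) :
    toControl T (c • f) = c • toControl T f :=
  ((eq_toControl (hf.const_smul c)).1 ((Lp.coeFn_smul _ _).trans
    ((coeFn_toControl T hf).const_smul c))).symm

variable {H : Type*} [NormedAddCommGroup H] [InnerProductSpace ℂ H]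

/-- Integral operators with a continuous operator-valued kernel are bounded on
`L₂([0, T]; B)`. -/
theorem exists_kernel_operator {T : ℝ} (hT : 0 ≤ T) {N : ℝ → B →L[ℂ] H} (hN : Continuous N) :
    ∃ J : ControlSpace B T →L[ℂ] H, ∀ f : ℝ → B, Continuous f →
      J (toControl T f) = ∫ s in (0 : ℝ)..T, N s (f s) := by
  obtain ⟨C, hC0, hC⟩ := exists_integral_norm_le (B := B) T
  obtain ⟨M, hM⟩ := (isCompact_Icc (a := (0 : ℝ)) (b := T)).exists_bound_of_continuousOn
    hN.continuousOn
  have hbd : ∀ φ : ControlSpace B T, ∀ᵐ s ∂volume.restrict (Set.Icc 0 T),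
      ‖N s (φ s)‖ ≤ M * ‖φ s‖ := fun φ => by
    filter_upwards [ae_restrict_mem measurableSet_Icc] with s hs
    exact (N s).le_of_opNorm_le (hM s hs) _
  have hint : ∀ φ : ControlSpace B T, Integrable (fun s => N s (φ s))
      (volume.restrict (Set.Icc 0 T)) := fun φ => by
    refine Integrable.mono' ((integrable_coeFn φ).norm.const_mul M) ?_ (hbd φ)
    have hap : Continuous fun p : (B →L[ℂ] H) × B => p.1 p.2 :=
      isBoundedBilinearMap_apply.continuous
    exact hap.comp_aestronglyMeasurable
      (hN.aestronglyMeasurable.prodMk (Lp.aestronglyMeasurable φ))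
  let J : ControlSpace B T →ₗ[ℂ] H :=
    { toFun := fun φ => ∫ s in Set.Icc 0 T, N s (φ s)
      map_add' := fun φ ψ => by
        rw [← integral_add (hint φ) (hint ψ)]
        refine integral_congr_ae ?_
        filter_upwards [Lp.coeFn_add φ ψ] with s hs
        rw [hs, Pi.add_apply, map_add]
      map_smul' := fun c φ => by
        rw [RingHom.id_apply, ← integral_smul]
        refine integral_congr_ae ?_
        filter_upwards [Lp.coeFn_smul c φ] with s hs
        rw [hs, Pi.smul_apply, map_smul] }
  refine ⟨J.mkContinuous (M * C) fun φ => ?_, fun f hf => ?_⟩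
  · refine (norm_integral_le_of_norm_le ((integrable_coeFn φ).norm.const_mul M) (hbd φ)).trans ?_
    rw [integral_const_mul, mul_assoc]
    exact mul_le_mul_of_nonneg_left (hC φ) ((norm_nonneg _).trans (hM 0 ⟨le_rfl, hT⟩))
  · rw [intervalIntegral.integral_of_le hT, ← integral_Icc_eq_integral_Ioc]
    refine integral_congr_ae ?_
    filter_upwards [coeFn_toControl T hf] with s hs
    rw [hs]

variable [CompleteSpace H] {K : H →L[ℂ] H} {P : B →L[ℂ] H}

/-- The state `wave K P f T` depends continuously on `f''`. -/
theorem exists_operator_wave (hK : 0 ≤ K) {T : ℝ} (hT : 0 ≤ T) : ∃ J : ControlSpace B T →L[ℂ] H,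
    ∀ f, IsSmoothControl f → J (toControl T (deriv (deriv f))) = wave K P f T := by
  have hs : Continuous fun s => sinOp K (T - s) := (continuous_sinOp hK).comp (by fun_prop)
  obtain ⟨J, hJ⟩ := exists_kernel_operator hT
    (N := fun s => ((T - s : ℝ) : ℂ) • P - sinOp K (T - s) ∘L P)
    (((Complex.continuous_ofReal.comp (by fun_prop)).smul continuous_const).sub
      (hs.clm_comp continuous_const))
  refine ⟨J, fun f hf => ?_⟩
  have hPf := (hf.clm_comp P)
  have h := hPf.integral_sub_smul_deriv_deriv T
  rw [hf.deriv_clm_comp, hf.deriv.deriv_clm_comp] at h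
  have hPf2 := (hf.deriv.deriv.clm_comp P).continuous
  have hi₁ : Continuous fun s => (T - s) • P (deriv (deriv f) s) :=
    (continuous_const.sub continuous_id).smul hPf2
  have hi₂ : Continuous fun s => sinOp K (T - s) (P (deriv (deriv f) s)) := hs.clm_apply hPf2
  rw [hJ _ hf.deriv.deriv.continuous, wave, ← h, duhamel, ← intervalIntegral.integral_sub
    (hi₁.intervalIntegrable _ _) (hi₂.intervalIntegrable _ _)]
  refine intervalIntegral.integral_congr fun s _ => ?_
  rw [sub_apply, smul_apply, Complex.coe_smul]
  rfl

/-- `K (wave K P f T)` depends continuously on `f`. -/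
theorem exists_operator_map_wave (hK : 0 ≤ K) {T : ℝ} (hT : 0 ≤ T) :
    ∃ J : ControlSpace B T →L[ℂ] H,
      ∀ f, IsSmoothControl f → J (toControl T f) = K (wave K P f T) := by
  have hs : Continuous fun s => sinOp K (T - s) := (continuous_sinOp hK).comp (by fun_prop)
  obtain ⟨J, hJ⟩ := exists_kernel_operator hT (N := fun s => sinOp K (T - s) ∘L P)
    (hs.clm_comp continuous_const)
  exact ⟨J, fun f hf => by rw [hJ _ hf.continuous, map_wave hK hf hT]; rfl⟩

theorem isSmoothControl_smul_const {φ : ℝ → ℂ} (hφ : IsSmoothControl φ) (b : B) :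
    IsSmoothControl fun t => φ t • b :=
  hφ.clm_comp (ContinuousLinearMap.toSpanSingleton ℂ b)

/-- The span of the separated controls `φ(t) b` with smooth scalar `φ` and `b ∈ D`. -/
def separatedControls (D : Submodule ℂ B) : Submodule ℂ (ℝ → B) :=
  Submodule.span ℂ {f | ∃ φ : ℝ → ℂ, IsSmoothControl φ ∧ ∃ b ∈ D, f = fun t => φ t • b}

theorem IsSmoothControl.of_mem_separatedControls {D : Submodule ℂ B} {f : ℝ → B}
    (hf : f ∈ separatedControls D) : IsSmoothControl f := by
  induction hf using Submodule.span_induction with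
  | mem f hf =>
    obtain ⟨φ, hφ, b, -, rfl⟩ := hf
    exact isSmoothControl_smul_const hφ b
  | zero => exact IsSmoothControl.zero
  | add f g _ _ hf hg => exact hf.add hg
  | smul c f _ hf => exact hf.smul c

/-- A test function with support in `(0, T)` vanishes near `0`. -/
theorem isSmoothControl_ofReal {g : ℝ → ℝ} {T : ℝ} (hg : ContDiff ℝ ∞ g)
    (hs : tsupport g ⊆ Set.Ioo 0 T) : IsSmoothControl fun t => (g t : ℂ) where
  smooth := Complex.ofRealCLM.contDiff.comp hg
  vanish := by
    have h0 : (tsupport g)ᶜ ∈ 𝓝 (0 : ℝ) :=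
      (isClosed_tsupport g).isOpen_compl.mem_nhds fun h => lt_irrefl _ (hs h).1
    obtain ⟨δ, hδ, hball⟩ := Metric.mem_nhds_iff.1 h0
    refine ⟨δ / 2, by positivity, fun t ht => ?_⟩
    have : g t = 0 := by
      by_contra hne
      have hmem : t ∈ tsupport g := subset_tsupport g hne
      refine hball ?_ hmem
      rw [Metric.mem_ball, Real.dist_0_eq_abs, abs_of_pos (hs hmem).1]
      linarith
    rw [this, Complex.ofReal_zero]

theorem exists_antideriv_mem_separatedControls {D : Submodule ℂ B} {f : ℝ → B}
    (hf : f ∈ separatedControls D) : ∃ g ∈ separatedControls D, deriv g = f := by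
  induction hf using Submodule.span_induction with
  | mem f hf =>
    obtain ⟨φ, hφ, b, hb, rfl⟩ := hf
    obtain ⟨h₁, h₂⟩ := hφ.integral
    refine ⟨fun t => (∫ s in (0 : ℝ)..t, φ s) • b, Submodule.subset_span ⟨_, h₁, b, hb, rfl⟩, ?_⟩
    refine (h₁.deriv_clm_comp (ContinuousLinearMap.toSpanSingleton ℂ b)).trans ?_
    rw [h₂]
    rfl
  | zero => exact ⟨0, zero_mem _, by simp [Pi.zero_def]⟩
  | add f g _ _ hf hg =>
    obtain ⟨F, hF, rfl⟩ := hf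
    obtain ⟨G, hG, rfl⟩ := hg
    exact ⟨F + G, add_mem hF hG, (IsSmoothControl.of_mem_separatedControls hF).deriv_add
      (IsSmoothControl.of_mem_separatedControls hG)⟩
  | smul c f _ hf =>
    obtain ⟨F, hF, rfl⟩ := hf
    exact ⟨c • F, Submodule.smul_mem _ c hF,
      (IsSmoothControl.of_mem_separatedControls hF).deriv_smul c⟩

variable [CompleteSpace B]

theorem exists_norm_toControl_le {T : ℝ} (hT : 0 ≤ T) : ∃ C : ℝ, ∀ f : ℝ → B, IsSmoothControl f →
    ‖toControl T f‖ ≤ C * ‖toControl T (deriv (deriv f))‖ := by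
  obtain ⟨C, hC0, hC⟩ := exists_integral_norm_le (B := B) T
  refine ⟨(measureUnivNNReal (volume.restrict (Set.Icc 0 T)) : ℝ) ^ 
      (2 : ENNReal).toReal⁻¹ * (T * C), fun f hf => ?_⟩
  have hpt : ∀ t ∈ Set.Icc 0 T, ‖f t‖ ≤ T * (C * ‖toControl T (deriv (deriv f))‖) := by
    intro t ht
    have hc : Continuous fun s => ‖deriv (deriv f) s‖ := hf.deriv.deriv.continuous.norm
    rw [← hf.integral_sub_smul_deriv_deriv t]
    have h1 : ‖∫ s in (0 : ℝ)..t, (t - s) • deriv (deriv f) s‖ ≤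
        ∫ s in (0 : ℝ)..t, T * ‖deriv (deriv f) s‖ := by
      refine intervalIntegral.norm_integral_le_of_norm_le ht.1 (Eventually.of_forall fun s hs => ?_)
        ((continuous_const.mul hc).intervalIntegrable _ _)
      rw [norm_smul, Real.norm_eq_abs, abs_of_nonneg (sub_nonneg.2 hs.2)]
      gcongr
      linarith [ht.2, hs.1]
    have h2 : ∫ s in (0 : ℝ)..t, ‖deriv (deriv f) s‖ ≤ ∫ s in (0 : ℝ)..T, ‖deriv (deriv f) s‖ :=
      intervalIntegral.integral_mono_interval le_rfl ht.1 ht.2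
        (Eventually.of_forall fun _ => norm_nonneg _) (hc.intervalIntegrable _ _)
    have h3 : ∫ s in (0 : ℝ)..T, ‖deriv (deriv f) s‖ ≤ C * ‖toControl T (deriv (deriv f))‖ := by
      refine le_trans (le_of_eq ?_) (hC _)
      rw [intervalIntegral.integral_of_le hT, ← integral_Icc_eq_integral_Ioc]
      refine integral_congr_ae ?_
      filter_upwards [coeFn_toControl T hf.deriv.deriv.continuous] with s hs
      rw [hs]
    rw [intervalIntegral.integral_const_mul] at h1
    exact h1.trans (by gcongr; exact h2.trans h3)
  rw [mul_assoc, mul_assoc]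
  refine Lp.norm_le_of_ae_bound (by positivity) ?_
  filter_upwards [coeFn_toControl T hf.continuous, ae_restrict_mem measurableSet_Icc] with t h ht
  rw [h]
  exact hpt t ht

theorem dense_toControl_separatedControls {D : Submodule ℂ B} (hD : Dense (D : Set B)) (T : ℝ) :
    Dense (toControl T '' (separatedControls D : Set (ℝ → B))) := by
  let V : Submodule ℂ (ControlSpace B T) :=
    { carrier := toControl T '' (separatedControls D : Set (ℝ → B))
      zero_mem' := ⟨0, zero_mem _, ((eq_toControl continuous_const).1 (Lp.coeFn_zero _ _ _)).symm⟩
      add_mem' := by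
        rintro _ _ ⟨f, hf, rfl⟩ ⟨g, hg, rfl⟩
        exact ⟨f + g, add_mem hf hg, toControl_add T
          (IsSmoothControl.of_mem_separatedControls hf).continuous
          (IsSmoothControl.of_mem_separatedControls hg).continuous⟩
      smul_mem' := by
        rintro c _ ⟨f, hf, rfl⟩
        exact ⟨c • f, Submodule.smul_mem _ c hf, toControl_smul T c
          (IsSmoothControl.of_mem_separatedControls hf).continuous⟩ }
  change Dense (V : Set (ControlSpace B T))
  rw [Submodule.dense_iff_topologicalClosure_eq_top, Submodule.topologicalClosure_eq_top_iff,
    Submodule.eq_bot_iff]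
  intro ψ hψ
  have key : ∀ g : ℝ → ℝ, ContDiff ℝ ∞ g → HasCompactSupport g → tsupport g ⊆ Set.Ioo 0 T →
      ∫ t, g t • ψ t = 0 := by
    intro g hg hgc hs
    have hφ := isSmoothControl_ofReal hg hs
    have hint : Integrable (fun t => g t • ψ t) (volume.restrict (Set.Icc 0 T)) := by
      obtain ⟨C, hC⟩ := hgc.exists_bound_of_continuous hg.continuous
      refine ((integrable_coeFn ψ).norm.const_mul C).mono'
        (hg.continuous.aestronglyMeasurable.smul (Lp.aestronglyMeasurable ψ))
        (Eventually.of_forall fun t => ?_)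
      rw [norm_smul]
      exact mul_le_mul_of_nonneg_right (hC t) (norm_nonneg _)
    rw [← setIntegral_eq_integral_of_forall_compl_eq_zero (s := Set.Icc 0 T) fun t ht => by
      rw [image_eq_zero_of_notMem_tsupport fun h => ht (Set.Ioo_subset_Icc_self (hs h)), zero_smul]]
    refine hD.eq_zero_of_inner_right ℂ fun b hb => ?_
    have h1 := (Submodule.mem_orthogonal _ _).1 hψ (toControl T fun t => (g t : ℂ) • b)
      ⟨_, Submodule.subset_span ⟨_, hφ, b, hb, rfl⟩, rfl⟩
    rw [L2.inner_def] at h1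
    rw [← integral_inner hint, ← h1]
    refine integral_congr_ae ?_
    filter_upwards [coeFn_toControl T (isSmoothControl_smul_const hφ b).continuous] with t ht
    rw [ht, inner_smul_left, Complex.conj_ofReal, ← Complex.coe_smul, inner_smul_right]
  have hloc : LocallyIntegrableOn ψ (Set.Ioo 0 T) volume :=
    (IntegrableOn.mono_set (integrable_coeFn ψ) Set.Ioo_subset_Icc_self).locallyIntegrableOn
  have h0 := isOpen_Ioo.ae_eq_zero_of_integral_contDiff_smul_eq_zero hloc key
  have h1 := (ae_restrict_iff' measurableSet_Ioo).2 h0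
  rw [Measure.restrict_congr_set Ioo_ae_eq_Icc] at h1
  exact (Lp.eq_zero_iff_ae_eq_zero).2 h1

/-- Every smooth control is approximated by separated ones, together with its second derivative. -/
theorem exists_seq_separatedControls {D : Submodule ℂ B} (hD : Dense (D : Set B)) {T : ℝ}
    (hT : 0 ≤ T) {f : ℝ → B} (hf : IsSmoothControl f) :
    ∃ F : ℕ → ℝ → B, (∀ n, F n ∈ separatedControls D) ∧
      Tendsto (fun n => toControl T (F n)) atTop (𝓝 (toControl T f)) ∧
      Tendsto (fun n => toControl T (deriv (deriv (F n)))) atTop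
        (𝓝 (toControl T (deriv (deriv f)))) := by
  obtain ⟨s, hs, hlim⟩ := mem_closure_iff_seq_limit.1
    (dense_toControl_separatedControls hD T (toControl T (deriv (deriv f))))
  choose p hp hps using hs
  choose q hq hqp using fun n => exists_antideriv_mem_separatedControls (hp n)
  choose F hF hFq using fun n => exists_antideriv_mem_separatedControls (hq n)
  have hlim' : Tendsto (fun n => toControl T (deriv (deriv (F n)))) atTop
      (𝓝 (toControl T (deriv (deriv f)))) := by
    simpa only [hFq, hqp, hps] using hlim
  refine ⟨F, hF, ?_, hlim'⟩
  obtain ⟨C, hC⟩ := exists_norm_toControl_le (B := B) hT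
  rw [tendsto_iff_norm_sub_tendsto_zero] at hlim' ⊢
  refine squeeze_zero (fun _ => norm_nonneg _) (fun n => ?_) (by simpa using hlim'.const_mul C)
  have hFs := IsSmoothControl.of_mem_separatedControls (hF n)
  have hneg : IsSmoothControl ((-1 : ℂ) • f) := hf.smul _
  have hsub : F n - f = F n + (-1 : ℂ) • f := by simp [sub_eq_add_neg]
  have h := hC (F n - f) (hsub ▸ hFs.add hneg)
  have hd : deriv (deriv (F n - f)) = deriv (deriv (F n)) - deriv (deriv f) := by
    rw [hsub, hFs.deriv_add hneg, hFs.deriv.deriv_add hneg.deriv, hf.deriv_smul,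
      hf.deriv.deriv_smul]
    simp [sub_eq_add_neg]
  rwa [hd, toControl_sub T hFs.continuous hf.continuous,
    toControl_sub T hFs.deriv.deriv.continuous hf.deriv.deriv.continuous] at h

end ControlSpace

/-! ### Graphs of restrictions and the Friedrichs extension -/

section PartialOperators

variable {E F : Type*} [AddCommGroup E] [Module ℂ E] [AddCommGroup F] [Module ℂ F]

theorem LinearPMap.mem_kernel_iff {Q : E →ₗ.[ℂ] F} {y : E} : y ∈ Q.kernel ↔ (y, 0) ∈ Q.graph := by
  rw [LinearPMap.kernel, Submodule.mem_map, LinearPMap.mem_graph_iff]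
  constructor
  · rintro ⟨x, hx, rfl⟩
    exact ⟨x, rfl, hx⟩
  · rintro ⟨x, hx, hx'⟩
    exact ⟨x, hx', hx⟩

theorem LinearPMap.mem_domRestrict_graph_iff {Q : E →ₗ.[ℂ] F} {S : Submodule ℂ E} {y : E} {z : F} :
    (y, z) ∈ (Q.domRestrict S).graph ↔ (y, z) ∈ Q.graph ∧ y ∈ S := by
  constructor
  · intro h
    exact ⟨LinearPMap.le_graph_of_le LinearPMap.domRestrict_le h,
      (LinearPMap.mem_domain_of_mem_graph h).1⟩
  · rintro ⟨h, hS⟩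
    obtain ⟨x, rfl, rfl⟩ := (LinearPMap.mem_graph_iff Q).1 h
    exact (LinearPMap.mem_graph_iff _).2 ⟨⟨x, hS, x.2⟩, rfl, LinearPMap.domRestrict_apply rfl⟩

/-- The form of `Q*` is nonnegative on the form domain of a nonnegative symmetric operator `Q`:
with
`sₙ → y` in the form norm, `(Q* y, y) = lim_n lim_m (s_m, Q s_n)`, and
`2 Re (s_m, Q s_n) ≥ - (Q (s_m - s_n), s_m - s_n)`. -/
theorem LinearPMap.re_inner_nonneg_of_mem_formDomain {H : Type*} [NormedAddCommGroup H]
    [InnerProductSpace ℂ H] [CompleteSpace H] {Q : H →ₗ.[ℂ] H} (hQ : Dense (Q.domain : Set H))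
    (hsym : Q.IsFormalAdjoint Q) (hpos : Q.IsPosDef) {y z : H} (hyz : (y, z) ∈ Q†.graph)
    (hy : y ∈ Q.formDomain) :
    0 ≤ (⟪z, y⟫_ℂ).re := by
  obtain ⟨κ, hκ, hpos⟩ := hpos
  have hnn : ∀ x : Q.domain, 0 ≤ (⟪Q x, (x : H)⟫_ℂ).re := fun x =>
    le_trans (by positivity) (hpos x)
  obtain ⟨s, hs, hs2⟩ := hy
  have hadj := (mem_adjoint_graph_iff hQ).1 hyz
  have hre : Tendsto (fun p : ℕ × ℕ => (⟪Q (s p.1 - s p.2), ((s p.1 - s p.2 : Q.domain) : H)⟫_ℂ).re)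
      atTop (𝓝 0) := (Complex.continuous_re.tendsto 0).comp hs2
  have hlow : ∀ ε > 0, -ε ≤ 2 * (⟪y, z⟫_ℂ).re := by
    intro ε hε
    obtain ⟨⟨N₁, N₂⟩, hN⟩ := eventually_atTop.1 (hre.eventually (gt_mem_nhds hε))
    have h1 : ∀ᶠ n in atTop, ∀ᶠ m in atTop, -ε ≤ 2 * (⟪Q (s n), (s m : H)⟫_ℂ).re := by
      filter_upwards [eventually_ge_atTop N₂] with n hn
      filter_upwards [eventually_ge_atTop N₁] with m hm
      have h2 := hN (m, n) ⟨hm, hn⟩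
      simp only [LinearPMap.map_sub, Submodule.coe_sub, inner_sub_left, inner_sub_right,
        Complex.sub_re] at h2
      have h3 : (⟪Q (s m), (s n : H)⟫_ℂ).re = (⟪Q (s n), (s m : H)⟫_ℂ).re := by
        rw [hsym, ← inner_conj_symm, Complex.conj_re]
      linarith [hnn (s m), hnn (s n)]
    have h2 : ∀ᶠ n in atTop, -ε ≤ 2 * (⟪(s n : H), z⟫_ℂ).re := by
      filter_upwards [h1] with n hn
      rw [← hadj (s n) (Q (s n)) (Q.mem_graph _)]
      exact ge_of_tendsto (((Complex.continuous_re.tendsto _).comp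
        (tendsto_const_nhds.inner hs)).const_mul 2) hn
    exact ge_of_tendsto (((Complex.continuous_re.tendsto _).comp
      (hs.inner tendsto_const_nhds)).const_mul 2) h2
  rw [← inner_conj_symm, Complex.conj_re]
  by_contra hneg
  have := hlow (-(⟪y, z⟫_ℂ).re) (by linarith)
  linarith

end PartialOperators

/-! ### The Poisson operator of a Green system -/

namespace GreenSystem

variable {H B : Type*} [NormedAddCommGroup H] [InnerProductSpace ℂ H]
  [NormedAddCommGroup B] [InnerProductSpace ℂ B] {G : GreenSystem H B}

theorem green_graph {u u' v v' : H} {a b c d : B} (hu : (u, u') ∈ G.A.graph)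
    (hv : (v, v') ∈ G.A.graph) (hua : (u, a) ∈ G.Γ₀.graph) (hub : (u, b) ∈ G.Γ₁.graph)
    (hvc : (v, c) ∈ G.Γ₀.graph) (hvd : (v, d) ∈ G.Γ₁.graph) :
    ⟪u', v⟫_ℂ - ⟪u, v'⟫_ℂ = ⟪a, d⟫_ℂ - ⟪b, c⟫_ℂ := by
  obtain ⟨x, rfl, rfl⟩ := (LinearPMap.mem_graph_iff _).1 hu
  obtain ⟨y, rfl, rfl⟩ := (LinearPMap.mem_graph_iff _).1 hv
  rw [G.green x y,
    LinearPMap.mem_graph_snd_inj _ (LinearPMap.mem_graph G.Γ₀ ⟨x, G.domain_le₀ x.2⟩) hua rfl,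
    LinearPMap.mem_graph_snd_inj _ (LinearPMap.mem_graph G.Γ₁ ⟨x, G.domain_le₁ x.2⟩) hub rfl,
    LinearPMap.mem_graph_snd_inj _ (LinearPMap.mem_graph G.Γ₀ ⟨y, G.domain_le₀ y.2⟩) hvc rfl,
    LinearPMap.mem_graph_snd_inj _ (LinearPMap.mem_graph G.Γ₁ ⟨y, G.domain_le₁ y.2⟩) hvd rfl]

theorem exists_Γ₁ {u u' : H} (hu : (u, u') ∈ G.A.graph) : ∃ b, (u, b) ∈ G.Γ₁.graph :=
  LinearPMap.mem_domain_iff.1 (G.domain_le₁ (LinearPMap.mem_domain_of_mem_graph hu))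

theorem mem_L_graph_iff {y z : H} :
    (y, z) ∈ G.L.graph ↔ (y, z) ∈ G.A.graph ∧ (y, 0) ∈ G.Γ₀.graph := by
  rw [L, LinearPMap.mem_domRestrict_graph_iff, LinearPMap.mem_kernel_iff]

theorem mem_L₀_graph_iff {y z : H} : (y, z) ∈ G.L₀.graph ↔
    (y, z) ∈ G.A.graph ∧ (y, 0) ∈ G.Γ₀.graph ∧ (y, 0) ∈ G.Γ₁.graph := by
  rw [L₀, LinearPMap.mem_domRestrict_graph_iff, Submodule.mem_inf, LinearPMap.mem_kernel_iff,
    LinearPMap.mem_kernel_iff]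

/-- The space `Γ₀ Dom A` of boundary values. -/
def traceSpace (G : GreenSystem H B) : Submodule ℂ B where
  carrier := {b | ∃ y ∈ G.A.domain, (y, b) ∈ G.Γ₀.graph}
  zero_mem' := ⟨0, zero_mem _, G.Γ₀.graph.zero_mem⟩
  add_mem' := by
    rintro a b ⟨y, hy, hy'⟩ ⟨z, hz, hz'⟩
    exact ⟨y + z, add_mem hy hz, add_mem hy' hz'⟩
  smul_mem' := by
    rintro c a ⟨y, hy, hy'⟩
    exact ⟨c • y, G.A.domain.smul_mem c hy, G.Γ₀.graph.smul_mem c hy'⟩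

theorem isControl_iff {f : ℝ → B} :
    G.IsControl f ↔ IsSmoothControl f ∧ ∀ t, f t ∈ G.traceSpace :=
  ⟨fun h => ⟨⟨h.smooth, h.vanish⟩, h.mem⟩, fun h => ⟨h.1.smooth, h.1.vanish, h.2⟩⟩

theorem IsControl.isSmoothControl {f : ℝ → B} (hf : G.IsControl f) : IsSmoothControl f :=
  (isControl_iff.1 hf).1

theorem isControl_of_mem_separatedControls {f : ℝ → B} (hf : f ∈ separatedControls G.traceSpace) :
    G.IsControl f := by
  refine isControl_iff.2 ⟨IsSmoothControl.of_mem_separatedControls hf, ?_⟩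
  induction hf using Submodule.span_induction with
  | mem f hf =>
    obtain ⟨φ, hφ, b, hb, rfl⟩ := hf
    exact fun t => G.traceSpace.smul_mem _ hb
  | zero => exact fun t => zero_mem _
  | add f g _ _ hf hg => exact fun t => add_mem (hf t) (hg t)
  | smul c f _ hf => exact fun t => G.traceSpace.smul_mem c (hf t)

variable [CompleteSpace H]

theorem IsRyzhov.mem_adjoint_iff (hG : G.IsRyzhov) {p : H × H} :
    p ∈ G.L₀†.graph ↔ p ∈ closure (G.A.graph : Set (H × H)) := by
  rw [← hG.closure_A, ← hG.closable_A.graph_closure_eq_closure_graph]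
  rfl

theorem IsRyzhov.mem_adjoint_of_mem (hG : G.IsRyzhov) {p : H × H} (hp : p ∈ G.A.graph) :
    p ∈ G.L₀†.graph :=
  hG.mem_adjoint_iff.2 (subset_closure hp)

variable [CompleteSpace B]

/-- The pair of the inverse `K = L⁻¹` and of the bounded Poisson operator `P`, which maps a boundary
value `b` in `Γ₀ Dom A` to the vector of `Ker A` with this boundary value. One has
`Γ₁ L⁻¹ = - P*`. -/
structure IsPoissonPair (G : GreenSystem H B) (K : H →L[ℂ] H) (P : B →L[ℂ] H) : Prop where
  nonneg : 0 ≤ K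
  injective : ∀ z, K z = 0 → z = 0
  mem_A : ∀ z, (K z, z) ∈ G.A.graph
  mem_Γ₀ : ∀ z, (K z, 0) ∈ G.Γ₀.graph
  mem_Γ₁ : ∀ z, (K z, -ContinuousLinearMap.adjoint P z) ∈ G.Γ₁.graph
  poisson_A : ∀ b ∈ G.traceSpace, (P b, 0) ∈ G.A.graph
  poisson_Γ₀ : ∀ b ∈ G.traceSpace, (P b, b) ∈ G.Γ₀.graph
  eq_add : ∀ {y z b}, (y, z) ∈ G.A.graph → (y, b) ∈ G.Γ₀.graph → y = P b + K z
  dense_traceSpace : Dense (G.traceSpace : Set B)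

/-- The operator `Γ₁ L⁻¹` is closed by Green's formula and the density of the boundary values of
`Ker A`, hence bounded; the Poisson operator is minus its adjoint. -/
theorem IsRyzhov.exists_isPoissonPair (hG : G.IsRyzhov) : ∃ K P, G.IsPoissonPair K P := by
  obtain ⟨K, hK⟩ := hG.inverse_L
  have hKL : ∀ z, (K z, z) ∈ G.L.graph := fun z => (hK _ _).2 rfl
  have hKA : ∀ z, (K z, z) ∈ G.A.graph := fun z => (mem_L_graph_iff.1 (hKL z)).1
  have hKΓ : ∀ z, (K z, 0) ∈ G.Γ₀.graph := fun z => (mem_L_graph_iff.1 (hKL z)).2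
  have hinj : ∀ z, K z = 0 → z = 0 := fun z hz => by
    have := hKA z
    rw [hz] at this
    exact LinearPMap.graph_fst_eq_zero_snd _ this rfl
  have hnonneg : 0 ≤ K := by
    rw [ContinuousLinearMap.nonneg_iff_isPositive, ContinuousLinearMap.isPositive_def]
    refine ⟨fun x y => ?_, fun x => ?_⟩
    · obtain ⟨a, ha⟩ := exists_Γ₁ (hKA x)
      obtain ⟨b, hb⟩ := exists_Γ₁ (hKA y)
      have := green_graph (hKA x) (hKA y) (hKΓ x) ha (hKΓ y) hb
      rw [inner_zero_left, inner_zero_right, sub_zero, sub_eq_zero] at this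
      exact this.symm
    · obtain ⟨h1, h2⟩ := (hG.friedrichs _ _).1 (hKL x)
      have := LinearPMap.re_inner_nonneg_of_mem_formDomain hG.dense_L₀
        hG.symmetric_L₀ hG.posDef_L₀ h1 h2
      rw [← inner_conj_symm, Complex.conj_re] at this
      exact this
  have hdom : ∀ z, K z ∈ G.Γ₁.domain := fun z =>
    G.domain_le₁ (LinearPMap.mem_domain_of_mem_graph (hKA z))
  let Q₀ : H →ₗ[ℂ] B := G.Γ₁.toFun ∘ₗ LinearMap.codRestrict G.Γ₁.domain (K : H →ₗ[ℂ] H) hdom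
  have hQ₀ : ∀ z, (K z, Q₀ z) ∈ G.Γ₁.graph := fun z => G.Γ₁.mem_graph ⟨K z, hdom z⟩
  have hgreen : ∀ h b, (h, 0) ∈ G.A.graph → (h, b) ∈ G.Γ₀.graph → ∀ z, ⟪b, Q₀ z⟫_ℂ = -⟪h, z⟫_ℂ := by
    intro h b hA hb z
    obtain ⟨c, hc⟩ := exists_Γ₁ hA
    have := green_graph hA (hKA z) hb hc (hKΓ z) (hQ₀ z)
    rw [inner_zero_left, inner_zero_right, zero_sub, sub_zero] at this
    exact this.symm
  have htrace : Dense {b : B | ∃ y ∈ G.A.kernel, (y, b) ∈ G.Γ₀.graph} :=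
    dense_iff_closure_eq.2 hG.closure_trace
  have hclosed : ∀ (u : ℕ → H) (x : H) (y : B), Tendsto u atTop (𝓝 x) →
      Tendsto (Q₀ ∘ u) atTop (𝓝 y) → y = Q₀ x := by
    intro u x y hu hy
    refine htrace.eq_of_inner_right ℂ fun b hb => ?_
    obtain ⟨h, hA, hΓ⟩ := hb
    have hlim := (tendsto_const_nhds (x := b)).inner hy (𝕜 := ℂ)
    have hlim' := ((tendsto_const_nhds (x := h)).inner hu (𝕜 := ℂ)).neg
    rw [hgreen h b (LinearPMap.mem_kernel_iff.1 hA) hΓ]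
    refine tendsto_nhds_unique hlim (hlim'.congr fun n => ?_)
    exact (hgreen h b (LinearPMap.mem_kernel_iff.1 hA) hΓ (u n)).symm
  let Q : H →L[ℂ] B := ContinuousLinearMap.ofSeqClosedGraph hclosed
  let P : B →L[ℂ] H := -ContinuousLinearMap.adjoint Q
  have hP : ∀ h b, (h, 0) ∈ G.A.graph → (h, b) ∈ G.Γ₀.graph → P b = h := by
    intro h b hA hb
    refine ext_inner_right ℂ fun z => ?_
    change ⟪-ContinuousLinearMap.adjoint Q b, z⟫_ℂ = _
    rw [inner_neg_left, ContinuousLinearMap.adjoint_inner_left]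
    change -⟪b, Q₀ z⟫_ℂ = _
    rw [hgreen h b hA hb, neg_neg]
  have hsub : ∀ {y z b}, (y, z) ∈ G.A.graph → (y, b) ∈ G.Γ₀.graph →
      (y - K z, (0 : H)) ∈ G.A.graph ∧ (y - K z, b) ∈ G.Γ₀.graph := by
    intro y z b hA hb
    exact ⟨by simpa using sub_mem hA (hKA z), by simpa using sub_mem hb (hKΓ z)⟩
  have hb : ∀ b ∈ G.traceSpace, (P b, (0 : H)) ∈ G.A.graph ∧ (P b, b) ∈ G.Γ₀.graph := by
    rintro b ⟨y, hy, hyb⟩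
    obtain ⟨z, hz⟩ := LinearPMap.mem_domain_iff.1 hy
    have := hsub hz hyb
    rwa [hP _ _ this.1 this.2]
  refine ⟨K, P, hnonneg, hinj, hKA, hKΓ, fun z => ?_, fun b h => (hb b h).1, fun b h => (hb b h).2,
    fun {y z b} hA hΓ => ?_, htrace.mono ?_⟩
  · have : -ContinuousLinearMap.adjoint P z = Q₀ z := by
      simp only [P, map_neg, ContinuousLinearMap.adjoint_adjoint, neg_apply, neg_neg]
      rfl
    rw [this]
    exact hQ₀ z
  · have := hsub hA hΓ
    rw [hP _ _ this.1 this.2, sub_add_cancel]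
  · rintro b ⟨y, hy, hyb⟩
    exact ⟨y, LinearPMap.mem_domain_of_mem_graph (LinearPMap.mem_kernel_iff.1 hy), hyb⟩

theorem IsPoissonPair.poisson_mem_adjoint {K : H →L[ℂ] H} {P : B →L[ℂ] H}
    (hP : G.IsPoissonPair K P) (hG : G.IsRyzhov) (b : B) : (P b, (0 : H)) ∈ G.L₀†.graph := by
  rw [hG.mem_adjoint_iff]
  exact map_mem_closure (f := fun b => (P b, (0 : H))) (by fun_prop)
    (hP.dense_traceSpace b) fun b hb => hP.poisson_A b hb

/-- `L₀` is determined by `L₀*`. This includes the closedness of `L₀`, which comes from the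
boundedness of `Γ₁ L⁻¹`. -/
theorem IsPoissonPair.mem_L₀_iff {K : H →L[ℂ] H} {P : B →L[ℂ] H}
    (hP : G.IsPoissonPair K P) (hG : G.IsRyzhov) {y z : H} :
    (y, z) ∈ G.L₀.graph ↔ ∀ a b, (a, b) ∈ G.L₀†.graph → ⟪b, y⟫_ℂ = ⟪a, z⟫_ℂ := by
  have hKsa : ∀ x w, ⟪K x, w⟫_ℂ = ⟪x, K w⟫_ℂ :=
    ((ContinuousLinearMap.nonneg_iff_isPositive K).1 hP.nonneg).isSymmetric
  constructor
  · intro h a b hab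
    have := (LinearPMap.mem_adjoint_graph_iff hG.dense_L₀).1 hab _ _ h
    rw [← inner_conj_symm, ← this, inner_conj_symm]
  · intro h
    have hy : y = K z := by
      refine ext_inner_left ℂ fun x => ?_
      rw [h _ _ (hG.mem_adjoint_of_mem (hP.mem_A x)), hKsa]
    have hPz : ContinuousLinearMap.adjoint P z = 0 := by
      refine ext_inner_left ℂ fun b => ?_
      rw [ContinuousLinearMap.adjoint_inner_right, ← h _ _ (hP.poisson_mem_adjoint hG b),
        inner_zero_left, inner_zero_right]
    have h1 := hP.mem_Γ₁ z
    rw [hPz, neg_zero] at h1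
    rw [hy]
    exact mem_L₀_graph_iff.2 ⟨hP.mem_A z, hP.mem_Γ₀ z, h1⟩

end GreenSystem

/-! ### Waves, the control operator and the response operator -/

namespace GreenSystem

variable {H B : Type*} [NormedAddCommGroup H] [InnerProductSpace ℂ H] [CompleteSpace H]
  [NormedAddCommGroup B] [InnerProductSpace ℂ B] [CompleteSpace B]
  {G : GreenSystem H B} {K : H →L[ℂ] H} {P : B →L[ℂ] H}

namespace IsPoissonPair

variable (hP : G.IsPoissonPair K P)
include hP

theorem wave_eq {f : ℝ → B} (hf : IsSmoothControl f) {t : ℝ} (ht : 0 ≤ t) :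
    wave K P f t = P (f t) + K (-wave K P (deriv (deriv f)) t) := by
  rw [← wave_eqn hP.nonneg hf ht, map_neg]
  abel

theorem wave_mem_A {f : ℝ → B} (hf : G.IsControl f) {t : ℝ} (ht : 0 ≤ t) :
    (wave K P f t, -wave K P (deriv (deriv f)) t) ∈ G.A.graph := by
  rw [hP.wave_eq hf.isSmoothControl ht]
  simpa using add_mem (hP.poisson_A _ (hf.mem t)) (hP.mem_A (-wave K P (deriv (deriv f)) t))

theorem wave_mem_Γ₀ {f : ℝ → B} (hf : G.IsControl f) {t : ℝ} (ht : 0 ≤ t) :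
    (wave K P f t, f t) ∈ G.Γ₀.graph := by
  rw [hP.wave_eq hf.isSmoothControl ht]
  simpa using add_mem (hP.poisson_Γ₀ _ (hf.mem t)) (hP.mem_Γ₀ (-wave K P (deriv (deriv f)) t))

theorem isWave {f : ℝ → B} (hf : G.IsControl f) : G.IsWave f (wave K P f) where
  contDiffOn := (contDiff_wave hP.nonneg 2 hf.isSmoothControl).contDiffOn
  eqn t ht := by
    rw [iteratedDerivWithin_eq_iteratedDeriv (uniqueDiffOn_Ici 0)
      (contDiff_wave hP.nonneg 2 hf.isSmoothControl).contDiffAt ht.le, iteratedDeriv_succ,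
      iteratedDeriv_one, deriv_wave hP.nonneg hf.isSmoothControl,
      deriv_wave hP.nonneg hf.isSmoothControl.deriv]
    exact hP.wave_mem_A hf ht.le
  init := wave_zero hf.isSmoothControl
  init' := by
    rw [(hasDerivAt_wave hP.nonneg hf.isSmoothControl 0).hasDerivWithinAt.derivWithin
      (uniqueDiffOn_Ici 0 0 Set.self_mem_Ici), wave_zero hf.isSmoothControl.deriv]
  bdry t ht := hP.wave_mem_Γ₀ hf ht

theorem map_isWave_eq_duhamel {f : ℝ → B} {u : ℝ → H} (hu : G.IsWave f u) {t : ℝ} (ht : 0 ≤ t) :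
    K (u t) = duhamel K (fun s => P (f s)) t := by
  refine map_eq_duhamel hP.nonneg (v₁ := derivWithin u (Set.Ici 0))
    (v₂ := iteratedDerivWithin 2 u (Set.Ici 0)) (fun s hs => ?_) (fun s hs => ?_)
    (hu.contDiffOn.continuousOn_iteratedDerivWithin le_rfl (uniqueDiffOn_Ici 0)) hu.init hu.init'
    (fun s hs => ?_) ht
  · exact (hu.contDiffOn.differentiableOn (by norm_num) s hs).hasDerivWithinAt
  · have hd := hu.contDiffOn.differentiableOn_iteratedDerivWithin (m := 1) (by norm_num)
      (uniqueDiffOn_Ici 0) s hs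
    have he : iteratedDerivWithin 1 u (Set.Ici 0) = derivWithin u (Set.Ici 0) :=
      iteratedDerivWithin_one
    rw [he] at hd
    have := hd.hasDerivWithinAt
    rwa [← he, ← iteratedDerivWithin_succ, he] at this
  · have := hP.eq_add (hu.eqn s hs) (hu.bdry s hs.le)
    rw [this, map_neg]
    abel

theorem eq_wave {f : ℝ → B} {u : ℝ → H} (hf : IsSmoothControl f) (hu : G.IsWave f u) {t : ℝ}
    (ht : 0 ≤ t) : u t = wave K P f t := by
  rw [← sub_eq_zero]
  apply hP.injective
  rw [map_sub, hP.map_isWave_eq_duhamel hu ht, map_wave hP.nonneg hf ht, sub_self]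

/-- Waves are causal. -/
theorem wave_congr {f g : ℝ → B} (hf : IsSmoothControl f) (hg : IsSmoothControl g) {t : ℝ}
    (ht : 0 ≤ t) (h : Set.EqOn f g (Set.Icc 0 t)) : wave K P f t = wave K P g t := by
  rw [← sub_eq_zero]
  apply hP.injective
  rw [map_sub, map_wave hP.nonneg hf ht, map_wave hP.nonneg hg ht, sub_eq_zero]
  refine intervalIntegral.integral_congr fun s hs => ?_
  rw [Set.uIcc_of_le ht] at hs
  simp only [h hs]

variable {T : ℝ}

theorem mem_controlGraph_iff (hT : 0 ≤ T) {p : ControlSpace B T × H} :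
    p ∈ G.controlGraph T ↔ ∃ f, G.IsControl f ∧ p = (toControl T f, wave K P f T) := by
  constructor
  · rintro ⟨f, u, hf, hu, h1, h2⟩
    exact ⟨f, hf, Prod.ext ((eq_toControl hf.smooth.continuous).1 h1)
      (h2.trans (hP.eq_wave hf.isSmoothControl hu hT))⟩
  · rintro ⟨f, hf, rfl⟩
    exact ⟨f, _, hf, hP.isWave hf, coeFn_toControl T hf.smooth.continuous, rfl⟩

/-- On the closure of the control operator, `K` after the operator is bounded, so the closure is an
operator as well. -/
theorem exists_operator_of_mem_closure (hT : 0 ≤ T) : ∃ J : ControlSpace B T →L[ℂ] H,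
    ∀ p ∈ closure (G.controlGraph T : Set (ControlSpace B T × H)), K p.2 = J p.1 := by
  obtain ⟨J, hJ⟩ := exists_operator_map_wave (P := P) hP.nonneg hT
  refine ⟨J, fun p hp => ?_⟩
  have hcl : IsClosed {p : ControlSpace B T × H | K p.2 = J p.1} :=
    isClosed_eq (by fun_prop) (by fun_prop)
  refine closure_minimal (fun q hq => ?_) hcl hp
  obtain ⟨f, hf, rfl⟩ := (hP.mem_controlGraph_iff hT).1 hq
  exact (hJ f hf.isSmoothControl).symm

theorem eq_zero_of_mem_closure (hT : 0 ≤ T) {p : ControlSpace B T × H}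
    (hp : p ∈ closure (G.controlGraph T : Set (ControlSpace B T × H))) (h0 : p.1 = 0) :
    p.2 = 0 := by
  obtain ⟨J, hJ⟩ := hP.exists_operator_of_mem_closure hT
  exact hP.injective _ (by rw [hJ p hp, h0, map_zero])

theorem graph_controlOperator (hT : 0 ≤ T) : (G.controlOperator T).graph = G.controlGraph T :=
  Submodule.toLinearPMap_graph_eq _ fun _ hp h0 =>
    hP.eq_zero_of_mem_closure hT (subset_closure hp) h0

theorem isClosable_controlOperator (hT : 0 ≤ T) : (G.controlOperator T).IsClosable := by
  refine ⟨(G.controlGraph T).topologicalClosure.toLinearPMap, ?_⟩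
  rw [Submodule.toLinearPMap_graph_eq, hP.graph_controlOperator hT]
  exact fun _ hp h0 => hP.eq_zero_of_mem_closure hT hp h0

theorem mem_closure_graph_iff (hT : 0 ≤ T) {p : ControlSpace B T × H} :
    p ∈ (G.controlOperator T).closure.graph ↔
      p ∈ closure (G.controlGraph T : Set (ControlSpace B T × H)) := by
  rw [← (hP.isClosable_controlOperator hT).graph_closure_eq_closure_graph,
    hP.graph_controlOperator hT]
  rfl

/-- Every smooth control, whatever its values, belongs to the domain of the closure of the control
operator. -/
theorem wave_mem_closure (hT : 0 ≤ T) {f : ℝ → B} (hf : IsSmoothControl f) :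
    (toControl T f, wave K P f T) ∈ (G.controlOperator T).closure.graph := by
  rw [hP.mem_closure_graph_iff hT]
  obtain ⟨F, hF, h1, h2⟩ := exists_seq_separatedControls hP.dense_traceSpace hT hf
  obtain ⟨J, hJ⟩ := exists_operator_wave (P := P) hP.nonneg hT
  refine mem_closure_iff_seq_limit.2 ⟨fun n => (toControl T (F n), wave K P (F n) T),
    fun n => ?_, ?_⟩
  · exact (hP.mem_controlGraph_iff hT).2 ⟨F n, isControl_of_mem_separatedControls (hF n), rfl⟩
  · refine h1.prodMk_nhds ?_
    rw [← hJ f hf]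
    refine ((J.continuous.tendsto _).comp h2).congr fun n => ?_
    exact hJ _ (IsSmoothControl.of_mem_separatedControls (hF n))

theorem dense_domain_controlOperator (hT : 0 ≤ T) :
    Dense ((G.controlOperator T).domain : Set (ControlSpace B T)) := by
  refine (dense_toControl_separatedControls hP.dense_traceSpace T).mono ?_
  rintro _ ⟨f, hf, rfl⟩
  refine LinearPMap.mem_domain_of_mem_graph (y := wave K P f T) ?_
  rw [hP.graph_controlOperator hT]
  exact (hP.mem_controlGraph_iff hT).2 ⟨f, isControl_of_mem_separatedControls hf, rfl⟩

theorem wave_mem_adjoint (hG : G.IsRyzhov) (hT : 0 ≤ T) {f : ℝ → B} (hf : IsSmoothControl f) :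
    (wave K P f T, -wave K P (deriv (deriv f)) T) ∈ G.L₀†.graph := by
  rw [hP.wave_eq hf hT]
  simpa using add_mem (hP.poisson_mem_adjoint hG (f T))
    (hG.mem_adjoint_of_mem (hP.mem_A (-wave K P (deriv (deriv f)) T)))

theorem closure_wave_eq (hG : G.IsRyzhov) (hT : 0 < T) (hc : G.IsControllable T) :
    closure {p : H × H | ∃ f, G.IsControl f ∧
      p = (wave K P f T, -wave K P (deriv (deriv f)) T)} = (G.L₀†.graph : Set (H × H)) := by
  have hgr : (G.L₀†.graph : Set (H × H)) = closure (G.A.graph : Set (H × H)) :=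
    Set.ext fun p => hG.mem_adjoint_iff
  apply Set.Subset.antisymm
  · refine closure_minimal ?_ (hgr ▸ isClosed_closure)
    rintro _ ⟨f, hf, rfl⟩
    exact hP.wave_mem_adjoint hG hT.le hf.isSmoothControl
  · rw [hgr, ← hc]
    refine closure_mono ?_
    rintro p ⟨f, u, hf, hu, h1, h2⟩
    have h3 : p.1 = wave K P f T := h1.trans (hP.eq_wave hf.isSmoothControl hu hT.le)
    exact ⟨f, hf, Prod.ext h3
      (LinearPMap.mem_graph_snd_inj _ h2 (hP.wave_mem_A hf hT.le) h3)⟩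

theorem dense_wave (hG : G.IsRyzhov) (hT : 0 < T) (hc : G.IsControllable T) :
    Dense {y : H | ∃ f, G.IsControl f ∧ y = wave K P f T} := by
  refine dense_closure.1 (G.dense_domain.mono fun y hy => ?_)
  obtain ⟨z, hz⟩ := LinearPMap.mem_domain_iff.1 hy
  have h1 : (y, z) ∈ (G.L₀†.graph : Set (H × H)) := hG.mem_adjoint_of_mem hz
  rw [← hP.closure_wave_eq hG hT hc] at h1
  refine map_mem_closure (f := Prod.fst) continuous_fst h1 ?_
  rintro _ ⟨f, hf, rfl⟩
  exact ⟨f, hf, rfl⟩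

/-- For a separated control the trace `Γ₁ u^f` is continuous. -/
theorem exists_continuous_response {f : ℝ → B} (hf : f ∈ separatedControls G.traceSpace) :
    ∃ r : ℝ → B, Continuous r ∧ ∀ t, 0 ≤ t → (wave K P f t, r t) ∈ G.Γ₁.graph := by
  induction hf using Submodule.span_induction with
  | mem f hf =>
    obtain ⟨φ, hφ, b, hb, rfl⟩ := hf
    have hs := isSmoothControl_smul_const hφ b
    obtain ⟨c, hc⟩ := exists_Γ₁ (hP.poisson_A b hb)
    refine ⟨fun t => φ t • c +
      -ContinuousLinearMap.adjoint P (-wave K P (deriv (deriv fun t => φ t • b)) t),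
      (hφ.continuous.smul continuous_const).add ((ContinuousLinearMap.continuous _).comp
        (continuous_wave hP.nonneg hs.deriv.deriv).neg).neg, fun t ht => ?_⟩
    rw [hP.wave_eq hs ht, map_smul]
    exact add_mem (G.Γ₁.graph.smul_mem (φ t) hc) (hP.mem_Γ₁ _)
  | zero =>
    refine ⟨0, continuous_const, fun t ht => ?_⟩
    rw [← hP.eq_wave IsSmoothControl.zero G.isWave_zero ht]
    exact G.Γ₁.graph.zero_mem
  | add f g hf' hg' hf hg =>
    obtain ⟨r, hr, hfr⟩ := hf
    obtain ⟨s, hs, hgs⟩ := hg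
    refine ⟨r + s, hr.add hs, fun t ht => ?_⟩
    rw [wave_add hP.nonneg (IsSmoothControl.of_mem_separatedControls hf')
      (IsSmoothControl.of_mem_separatedControls hg')]
    exact add_mem (hfr t ht) (hgs t ht)
  | smul c f hf' hf =>
    obtain ⟨r, hr, hfr⟩ := hf
    refine ⟨c • r, hr.const_smul c, fun t ht => ?_⟩
    rw [wave_smul c (IsSmoothControl.of_mem_separatedControls hf')]
    exact G.Γ₁.graph.smul_mem c (hfr t ht)

theorem graph_responseOperator (hT : 0 < T) : (G.responseOperator T).graph = G.responseGraph T := by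
  refine Submodule.toLinearPMap_graph_eq _ ?_
  rintro p ⟨f, u, hf, hu, h1, h2⟩ h0
  rw [h0] at h1
  have hf0 : Set.EqOn f 0 (Set.Icc 0 T) :=
    Measure.eqOn_Icc_of_ae_eq volume hT.ne (h1.symm.trans (Lp.coeFn_zero _ _ _))
      hf.smooth.continuous.continuousOn continuousOn_const
  rw [Lp.eq_zero_iff_ae_eq_zero]
  filter_upwards [h2, ae_restrict_mem measurableSet_Icc] with t ht htT
  have hu0 : u t = 0 := by
    rw [hP.eq_wave hf.isSmoothControl hu htT.1, hP.wave_congr hf.isSmoothControl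
      IsSmoothControl.zero htT.1 (hf0.mono (Set.Icc_subset_Icc_right htT.2)),
      ← hP.eq_wave IsSmoothControl.zero G.isWave_zero htT.1]
    rfl
  exact LinearPMap.graph_fst_eq_zero_snd _ ht hu0

end IsPoissonPair

end GreenSystem

/-! ### The modulus and the polar decomposition -/

section Modulus

variable {E F F₁ F₂ : Type*} [NormedAddCommGroup E] [InnerProductSpace ℂ E] [CompleteSpace E]
  [NormedAddCommGroup F] [InnerProductSpace ℂ F]
  [NormedAddCommGroup F₁] [InnerProductSpace ℂ F₁] [CompleteSpace F₁]
  [NormedAddCommGroup F₂] [InnerProductSpace ℂ F₂] [CompleteSpace F₂]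

theorem LinearPMap.mem_adjoint_closure_graph {W : E →ₗ.[ℂ] F} (hW : Dense (W.domain : Set E))
    (hc : W.IsClosable) {p : F × E} : p ∈ W†.graph ↔ p ∈ W.closure.graph.adjoint := by
  rw [LinearPMap.adjoint_graph_eq_graph_adjoint hW, Submodule.mem_adjoint_iff,
    Submodule.mem_adjoint_iff, ← hc.graph_closure_eq_closure_graph]
  refine ⟨fun h a b hab => ?_, fun h a b hab => h a b (W.graph.le_topologicalClosure hab)⟩
  have hcl : _root_.IsClosed {q : E × F | ⟪q.2, p.1⟫_ℂ - ⟪q.1, p.2⟫_ℂ = 0} :=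
    isClosed_eq (by fun_prop) continuous_const
  exact closure_minimal (fun q hq => h q.1 q.2 hq) hcl hab

variable [CompleteSpace F]

theorem LinearPMap.IsModulus.exists_norm_eq {S : E →ₗ.[ℂ] E} {W : E →ₗ.[ℂ] F}
    (hS : S.IsModulus W) (hW : Dense (W.domain : Set E)) (hc : W.IsClosable) {x : E} :
    (∀ {y}, (x, y) ∈ S.graph → ∃ w, (x, w) ∈ W.closure.graph ∧ ‖w‖ = ‖y‖) ∧
    (∀ {w}, (x, w) ∈ W.closure.graph → ∃ y, (x, y) ∈ S.graph ∧ ‖y‖ = ‖w‖) := by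
  have hadj : ∀ p, p ∈ S.graph ↔ p ∈ S.graph.adjoint := fun p => by
    rw [← LinearPMap.adjoint_graph_eq_graph_adjoint hS.1.dense_domain,
      LinearPMap.isSelfAdjoint_def.1 hS.1]
  have hsq := hS.2.2
  simp only [fun y z => hadj (y, z), LinearPMap.mem_adjoint_closure_graph hW hc] at hsq
  simp only [← fun y z => hadj (y, z)] at hsq
  have h0 : ∀ y, ((0 : E), y) ∈ S.graph → y = 0 := fun y hy =>
    LinearPMap.graph_fst_eq_zero_snd _ hy rfl
  have h0' : ∀ y, ((0 : E), y) ∈ W.closure.graph → y = 0 := fun y hy =>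
    LinearPMap.graph_fst_eq_zero_snd _ hy rfl
  refine ⟨fun {y} hy => ?_, fun {w} hw => ?_⟩
  · refine Submodule.exists_norm_eq_of_adjoint_mul_eq hS.1.isClosed h0 hc.closure_isClosed h0'
      (fun x z => ?_) hy
    simp only [← fun y z => hadj (y, z)]
    exact (hsq x z).1
  · refine Submodule.exists_norm_eq_of_adjoint_mul_eq hc.closure_isClosed h0' hS.1.isClosed h0
      (fun x z => ?_) hw
    simp only [← fun y z => hadj (y, z)]
    exact (hsq x z).2

/-- The polar decomposition: `S y ↦ W y` extends to a unitary operator when `W` has dense range. -/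
theorem LinearPMap.IsModulus.exists_polar {S : E →ₗ.[ℂ] E} {W : E →ₗ.[ℂ] F}
    (hS : S.IsModulus W) (hW : Dense (W.domain : Set E)) (hc : W.IsClosable)
    (hr : Dense {y | ∃ x, (x, y) ∈ W.closure.graph}) :
    ∃ U : S.closedRange ≃ₗᵢ[ℂ] F, ∀ (x : E) (w : F), (x, w) ∈ W.closure.graph ↔
      ∃ y : S.closedRange, (x, (y : E)) ∈ S.graph ∧ U y = w := by
  let R : Submodule ℂ (E × F) :=
    { carrier := {p | ∃ x, (x, p.1) ∈ S.graph ∧ (x, p.2) ∈ W.closure.graph}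
      zero_mem' := ⟨0, S.graph.zero_mem, W.closure.graph.zero_mem⟩
      add_mem' := by
        rintro p q ⟨x, hx, hx'⟩ ⟨y, hy, hy'⟩
        exact ⟨x + y, add_mem hx hy, add_mem hx' hy'⟩
      smul_mem' := by
        rintro c p ⟨x, hx, hx'⟩
        exact ⟨c • x, S.graph.smul_mem c hx, W.closure.graph.smul_mem c hx'⟩ }
  have hR : ∀ p ∈ R, ‖p.1‖ = ‖p.2‖ := by
    rintro p ⟨x, hx, hx'⟩
    obtain ⟨w, hw, hwn⟩ := (hS.exists_norm_eq hW hc).1 hx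
    rw [← hwn, LinearPMap.mem_graph_snd_inj _ hw hx' rfl]
  obtain ⟨U, hU⟩ := Submodule.exists_unitary_of_norm_eq hR (M := S.closedRange)
    (hr.mono (by
      rintro w ⟨x, hx⟩
      obtain ⟨y, hy, -⟩ := (hS.exists_norm_eq hW hc).2 hx
      exact ⟨(y, w), ⟨x, hy, hx⟩, rfl⟩))
    (by
      rw [LinearPMap.closedRange, Submodule.topologicalClosure_coe]
      congr 1
      ext y
      constructor
      · rintro ⟨x, rfl⟩
        obtain ⟨w, hw, -⟩ := (hS.exists_norm_eq hW hc).1 (S.mem_graph x)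
        exact ⟨(S x, w), ⟨x, S.mem_graph x, hw⟩, rfl⟩
      · rintro ⟨p, ⟨x, hx, -⟩, rfl⟩
        obtain ⟨x', -, hx'⟩ := (LinearPMap.mem_graph_iff _).1 hx
        exact ⟨x', hx'⟩)
  refine ⟨U, fun x w => ⟨fun hw => ?_, ?_⟩⟩
  · obtain ⟨y, hy, -⟩ := (hS.exists_norm_eq hW hc).2 hw
    obtain ⟨hm, hUy⟩ := hU (y, w) ⟨x, hy, hw⟩
    exact ⟨⟨y, hm⟩, hy, hUy⟩
  · rintro ⟨y, hy, rfl⟩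
    obtain ⟨w, hw, -⟩ := (hS.exists_norm_eq hW hc).1 hy
    obtain ⟨hm, hUy⟩ := hU ((y : E), w) ⟨x, hy, hw⟩
    rwa [show U y = w from hUy]

/-- Two operators with the same modulus have closures with the same domain and the same norms. -/
theorem LinearPMap.IsModulus.norm_eq {S : E →ₗ.[ℂ] E} {W₁ : E →ₗ.[ℂ] F₁} {W₂ : E →ₗ.[ℂ] F₂}
    (h₁ : S.IsModulus W₁) (h₂ : S.IsModulus W₂) (hd₁ : Dense (W₁.domain : Set E))
    (hd₂ : Dense (W₂.domain : Set E)) (hc₁ : W₁.IsClosable) (hc₂ : W₂.IsClosable) {x : E} {y : F₁}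
    {z : F₂} (hy : (x, y) ∈ W₁.closure.graph) (hz : (x, z) ∈ W₂.closure.graph) : ‖y‖ = ‖z‖ := by
  obtain ⟨a, ha, ha'⟩ := (h₁.exists_norm_eq hd₁ hc₁).2 hy
  obtain ⟨b, hb, hb'⟩ := (h₂.exists_norm_eq hd₂ hc₂).2 hz
  rw [← ha', ← hb', LinearPMap.mem_graph_snd_inj _ ha hb rfl]

end Modulus

/-! ### Reconstruction up to unitary equivalence -/

namespace GreenSystem

variable {H H₁ H₂ B : Type*} [NormedAddCommGroup H] [InnerProductSpace ℂ H] [CompleteSpace H]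
  [NormedAddCommGroup H₁] [InnerProductSpace ℂ H₁] [CompleteSpace H₁]
  [NormedAddCommGroup H₂] [InnerProductSpace ℂ H₂]
  [NormedAddCommGroup B] [InnerProductSpace ℂ B] [CompleteSpace B]
  {G : GreenSystem H B} {G₁ : GreenSystem H₁ B} {G₂ : GreenSystem H₂ B}
  {K : H →L[ℂ] H} {P : B →L[ℂ] H} {K₁ : H₁ →L[ℂ] H₁} {P₁ : B →L[ℂ] H₁}
  {K₂ : H₂ →L[ℂ] H₂} {P₂ : B →L[ℂ] H₂} {T : ℝ}

theorem IsPoissonPair.closure_wave_smooth_eq (hP : G.IsPoissonPair K P) (hG : G.IsRyzhov)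
    (hT : 0 < T) (hc : G.IsControllable T) :
    closure {p : H × H | ∃ f : ℝ → B, IsSmoothControl f ∧
      p = (wave K P f T, -wave K P (deriv (deriv f)) T)} = (G.L₀†.graph : Set (H × H)) := by
  have h := hP.closure_wave_eq hG hT hc
  apply Set.Subset.antisymm
  · refine closure_minimal ?_ (h ▸ isClosed_closure)
    rintro _ ⟨f, hf, rfl⟩
    exact hP.wave_mem_adjoint hG hT.le hf
  · rw [← h]
    refine closure_mono ?_
    rintro _ ⟨f, hf, rfl⟩
    exact ⟨f, hf.isSmoothControl, rfl⟩

theorem IsPoissonPair.mem_responseGraph (hP : G.IsPoissonPair K P) {f r : ℝ → B}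
    (hf : G.IsControl f) (hr : Continuous r)
    (h : ∀ t, 0 ≤ t → (wave K P f t, r t) ∈ G.Γ₁.graph) (T : ℝ) :
    (toControl T f, toControl T r) ∈ G.responseGraph T := by
  refine ⟨f, _, hf, hP.isWave hf, coeFn_toControl T hf.smooth.continuous, ?_⟩
  filter_upwards [coeFn_toControl T hr, ae_restrict_mem measurableSet_Icc] with t ht htT
  rw [ht]
  exact h t htT.1

/-- The domain of the response operator determines the space of boundary values. -/
theorem traceSpace_le_of_responseGraph_le (hP₁ : G₁.IsPoissonPair K₁ P₁) (hT : 0 < T)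
    (h : G₁.responseGraph T ≤ G₂.responseGraph T) : G₁.traceSpace ≤ G₂.traceSpace := by
  intro b hb
  have hφ : IsSmoothControl fun t => (Real.smoothTransition (2 * t / T - 1) : ℂ) :=
    { smooth := Complex.ofRealCLM.contDiff.comp (Real.smoothTransition.contDiff.comp (by fun_prop))
      vanish := ⟨T / 2, by positivity, fun t ht => by
        rw [Real.smoothTransition.zero_of_nonpos, Complex.ofReal_zero]
        rw [sub_nonpos, div_le_one hT]
        linarith⟩ }
  have hf : (fun t => (Real.smoothTransition (2 * t / T - 1) : ℂ) • b) ∈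
      separatedControls G₁.traceSpace := Submodule.subset_span ⟨_, hφ, b, hb, rfl⟩
  obtain ⟨r, hr, hfr⟩ := hP₁.exists_continuous_response hf
  obtain ⟨f₂, u₂, hf₂, -, h1, -⟩ :=
    h (hP₁.mem_responseGraph (isControl_of_mem_separatedControls hf) hr hfr T)
  have hfc := (isSmoothControl_smul_const hφ b).continuous
  have heq := Measure.eqOn_Icc_of_ae_eq volume hT.ne ((coeFn_toControl T hfc).symm.trans h1)
    hfc.continuousOn hf₂.smooth.continuous.continuousOn ⟨hT.le, le_rfl⟩
  have h1T : Real.smoothTransition (2 * T / T - 1) = 1 := by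
    rw [mul_div_cancel_right₀ _ hT.ne']
    exact Real.smoothTransition.one_of_one_le (by norm_num)
  simp only [h1T, Complex.ofReal_one, one_smul] at heq
  rw [heq]
  exact hf₂.mem T

variable [CompleteSpace H₂]

/-- If all smooth controls produce states of equal norms, then the correspondence of states is a
unitary equivalence of the operators `L₀*`. -/
theorem unitarilyEquivalent_of_norm_wave_eq (hP₁ : G₁.IsPoissonPair K₁ P₁)
    (hP₂ : G₂.IsPoissonPair K₂ P₂) (hG₁ : G₁.IsRyzhov) (hG₂ : G₂.IsRyzhov) (hT : 0 < T)
    (hc₁ : G₁.IsControllable T) (hc₂ : G₂.IsControllable T)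
    (h : ∀ f : ℝ → B, IsSmoothControl f → ‖wave K₁ P₁ f T‖ = ‖wave K₂ P₂ f T‖) :
    (G₁.L₀†).UnitarilyEquivalent (G₂.L₀†) := by
  let R : Submodule ℂ (H₁ × H₂) :=
    { carrier := {p | ∃ f : ℝ → B, IsSmoothControl f ∧ p = (wave K₁ P₁ f T, wave K₂ P₂ f T)}
      zero_mem' := ⟨0, IsSmoothControl.zero, by
        rw [← hP₁.eq_wave IsSmoothControl.zero G₁.isWave_zero hT.le,
          ← hP₂.eq_wave IsSmoothControl.zero G₂.isWave_zero hT.le]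
        rfl⟩
      add_mem' := by
        rintro _ _ ⟨f, hf, rfl⟩ ⟨g, hg, rfl⟩
        refine ⟨f + g, hf.add hg, ?_⟩
        rw [wave_add hP₁.nonneg hf hg, wave_add hP₂.nonneg hf hg]
        rfl
      smul_mem' := by
        rintro c _ ⟨f, hf, rfl⟩
        refine ⟨c • f, hf.smul c, ?_⟩
        rw [wave_smul c hf, wave_smul c hf]
        rfl }
  have hd₁ : Dense (Prod.fst '' (R : Set (H₁ × H₂))) := (hP₁.dense_wave hG₁ hT hc₁).mono (by
    rintro _ ⟨f, hf, rfl⟩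
    exact ⟨_, ⟨f, hf.isSmoothControl, rfl⟩, rfl⟩)
  have hd₂ : Dense (Prod.snd '' (R : Set (H₁ × H₂))) := (hP₂.dense_wave hG₂ hT hc₂).mono (by
    rintro _ ⟨f, hf, rfl⟩
    exact ⟨_, ⟨f, hf.isSmoothControl, rfl⟩, rfl⟩)
  obtain ⟨U, hU⟩ := Submodule.exists_unitary_of_norm_eq (R := R)
    (by rintro _ ⟨f, hf, rfl⟩; exact h f hf) hd₂ (M := ⊤)
    (by rw [hd₁.closure_eq, Submodule.top_coe])
  let V : H₁ ≃ₗᵢ[ℂ] H₂ := (LinearIsometryEquiv.ofTop H₁ ⊤ rfl).symm.trans U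
  have hV : ∀ f : ℝ → B, IsSmoothControl f → V (wave K₁ P₁ f T) = wave K₂ P₂ f T := fun f hf =>
    (hU _ ⟨f, hf, rfl⟩).2
  refine ⟨V, fun y z => ?_⟩
  rw [← SetLike.mem_coe, ← SetLike.mem_coe, ← hP₁.closure_wave_smooth_eq hG₁ hT hc₁,
    ← hP₂.closure_wave_smooth_eq hG₂ hT hc₂]
  constructor
  · intro hyz
    refine map_mem_closure (f := Prod.map V V) (V.continuous.prodMap V.continuous) hyz ?_
    rintro _ ⟨f, hf, rfl⟩
    exact ⟨f, hf, by rw [Prod.map_apply, map_neg, hV f hf, hV _ hf.deriv.deriv]⟩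
  · intro hyz
    have := map_mem_closure (f := Prod.map V.symm V.symm)
      (t := {p | ∃ f : ℝ → B, IsSmoothControl f ∧
        p = (wave K₁ P₁ f T, -wave K₁ P₁ (deriv (deriv f)) T)})
      (V.symm.continuous.prodMap V.symm.continuous) hyz (by
        rintro _ ⟨f, hf, rfl⟩
        refine ⟨f, hf, ?_⟩
        rw [Prod.map_apply, map_neg, ← hV f hf, ← hV _ hf.deriv.deriv, V.symm_apply_apply,
          V.symm_apply_apply])
    simpa using this

theorem unitarilyEquivalent_L₀ (hP₁ : G₁.IsPoissonPair K₁ P₁) (hP₂ : G₂.IsPoissonPair K₂ P₂)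
    (hG₁ : G₁.IsRyzhov) (hG₂ : G₂.IsRyzhov) (h : (G₁.L₀†).UnitarilyEquivalent (G₂.L₀†)) :
    G₁.L₀.UnitarilyEquivalent G₂.L₀ := by
  obtain ⟨V, hV⟩ := h
  refine ⟨V, fun y z => ?_⟩
  rw [hP₁.mem_L₀_iff hG₁, hP₂.mem_L₀_iff hG₂]
  constructor
  · intro h a b hab
    obtain ⟨a, rfl⟩ := V.surjective a
    obtain ⟨b, rfl⟩ := V.surjective b
    rw [V.inner_map_map, V.inner_map_map]
    exact h a b ((hV a b).2 hab)
  · intro h a b hab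
    have := h _ _ ((hV a b).1 hab)
    rwa [V.inner_map_map, V.inner_map_map] at this

/-! ### The response determines the norms of the states -/

/-- The derivative of `(u(t), u(s))`, `u = u^f`, in the direction `(1, 1)` has along the line
`t + s = c` a derivative that Green's formula expresses through the control and the response. -/
theorem IsPoissonPair.hasDerivAt_characteristic (hP : G.IsPoissonPair K P) {f r : ℝ → B}
    (hf : G.IsControl f) {c x : ℝ} (hx : 0 ≤ x) (hxc : x ≤ c)
    (hr : (wave K P f x, r x) ∈ G.Γ₁.graph) (hr' : (wave K P f (c - x), r (c - x)) ∈ G.Γ₁.graph) :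
    HasDerivAt (fun x => ⟪wave K P (deriv f) x, wave K P f (c - x)⟫_ℂ +
        ⟪wave K P f x, wave K P (deriv f) (c - x)⟫_ℂ)
      (⟪r x, f (c - x)⟫_ℂ - ⟪f x, r (c - x)⟫_ℂ) x := by
  have hs := hf.isSmoothControl
  have d0 := hasDerivAt_wave (P := P) hP.nonneg hs
  have d1 := hasDerivAt_wave (P := P) hP.nonneg hs.deriv
  have h := (HasDerivAt.inner ℂ (d1 x) ((d0 (c - x)).comp_const_sub c x)).fun_add
    (HasDerivAt.inner ℂ (d0 x) ((d1 (c - x)).comp_const_sub c x))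
  have hg := green_graph (hP.wave_mem_A hf hx) (hP.wave_mem_A hf (sub_nonneg.2 hxc))
    (hP.wave_mem_Γ₀ hf hx) hr (hP.wave_mem_Γ₀ hf (sub_nonneg.2 hxc)) hr'
  refine h.congr_deriv ?_
  simp only [inner_neg_left, inner_neg_right] at hg ⊢
  linear_combination -hg

/-- The norm of the state at the time `T` is determined by the response on `[0, 2T]`: the functions
`(u₁(t), u₁(s))` and `(u₂(t), u₂(s))` solve the same wave equation in `t + s ≤ 2T` with zero Cauchy
data, and integration along characteristics shows that they are equal on the diagonal. -/
theorem norm_wave_eq_of_response (hP₁ : G₁.IsPoissonPair K₁ P₁) (hP₂ : G₂.IsPoissonPair K₂ P₂)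
    (hT : 0 ≤ T) {f r : ℝ → B} (hf₁ : G₁.IsControl f) (hf₂ : G₂.IsControl f)
    (hr₁ : ∀ t ∈ Set.Icc 0 (2 * T), (wave K₁ P₁ f t, r t) ∈ G₁.Γ₁.graph)
    (hr₂ : ∀ t ∈ Set.Icc 0 (2 * T), (wave K₂ P₂ f t, r t) ∈ G₂.Γ₁.graph) :
    ‖wave K₁ P₁ f T‖ = ‖wave K₂ P₂ f T‖ := by
  have hs := hf₁.isSmoothControl
  have hchar : ∀ x ∈ Set.Icc 0 T,
      ⟪wave K₁ P₁ (deriv f) x, wave K₁ P₁ f x⟫_ℂ + ⟪wave K₁ P₁ f x, wave K₁ P₁ (deriv f) x⟫_ℂ =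
      ⟪wave K₂ P₂ (deriv f) x, wave K₂ P₂ f x⟫_ℂ + ⟪wave K₂ P₂ f x, wave K₂ P₂ (deriv f) x⟫_ℂ := by
    intro y hy
    have hd : ∀ x ∈ Set.Icc 0 (2 * y), HasDerivAt (fun x =>
        (⟪wave K₁ P₁ (deriv f) x, wave K₁ P₁ f (2 * y - x)⟫_ℂ +
          ⟪wave K₁ P₁ f x, wave K₁ P₁ (deriv f) (2 * y - x)⟫_ℂ) -
        (⟪wave K₂ P₂ (deriv f) x, wave K₂ P₂ f (2 * y - x)⟫_ℂ +
          ⟪wave K₂ P₂ f x, wave K₂ P₂ (deriv f) (2 * y - x)⟫_ℂ)) 0 x := by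
      intro x hx
      have hx1 : x ∈ Set.Icc 0 (2 * T) := ⟨hx.1, by linarith [hx.2, hy.2]⟩
      have hx2 : 2 * y - x ∈ Set.Icc 0 (2 * T) := ⟨by linarith [hx.2], by linarith [hx.1, hy.2]⟩
      have := (hP₁.hasDerivAt_characteristic hf₁ hx.1 hx.2 (hr₁ x hx1) (hr₁ _ hx2)).fun_sub
        (hP₂.hasDerivAt_characteristic hf₂ hx.1 hx.2 (hr₂ x hx1) (hr₂ _ hx2))
      rwa [sub_self] at this
    have := constant_of_has_deriv_right_zero
      (fun x hx => (hd x hx).continuousAt.continuousWithinAt)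
      (fun x hx => (hd x (Set.Ico_subset_Icc_self hx)).hasDerivWithinAt) y
      ⟨hy.1, by linarith [hy.1]⟩
    simp only [wave_zero hs, wave_zero hs.deriv, inner_zero_left, add_zero, sub_zero,
      show 2 * y - y = y by ring] at this
    exact sub_eq_zero.1 this
  have hd : ∀ x ∈ Set.Icc 0 T, HasDerivAt (fun x =>
      ⟪wave K₁ P₁ f x, wave K₁ P₁ f x⟫_ℂ - ⟪wave K₂ P₂ f x, wave K₂ P₂ f x⟫_ℂ) 0 x := by
    intro x hx
    have d1 := hasDerivAt_wave (P := P₁) hP₁.nonneg hs x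
    have d2 := hasDerivAt_wave (P := P₂) hP₂.nonneg hs x
    refine ((HasDerivAt.inner ℂ d1 d1).fun_sub (HasDerivAt.inner ℂ d2 d2)).congr_deriv ?_
    linear_combination hchar x hx
  have := constant_of_has_deriv_right_zero
    (fun x hx => (hd x hx).continuousAt.continuousWithinAt)
    (fun x hx => (hd x (Set.Ico_subset_Icc_self hx)).hasDerivWithinAt) T ⟨hT, le_rfl⟩
  simp only [wave_zero hs, inner_zero_left, sub_zero] at this
  rw [@norm_eq_sqrt_re_inner ℂ _ _ _ _ (wave K₁ P₁ f T),
    @norm_eq_sqrt_re_inner ℂ _ _ _ _ (wave K₂ P₂ f T), sub_eq_zero.1 this]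

theorem norm_wave_eq_of_responseOperator_eq (hP₁ : G₁.IsPoissonPair K₁ P₁)
    (hP₂ : G₂.IsPoissonPair K₂ P₂) (hT : 0 < T)
    (h : G₁.responseOperator (2 * T) = G₂.responseOperator (2 * T)) {f : ℝ → B}
    (hf : IsSmoothControl f) : ‖wave K₁ P₁ f T‖ = ‖wave K₂ P₂ f T‖ := by
  have h2T : 0 < 2 * T := by positivity
  have hgr : G₁.responseGraph (2 * T) = G₂.responseGraph (2 * T) := by
    rw [← hP₁.graph_responseOperator h2T, h, hP₂.graph_responseOperator h2T]
  have htr : G₁.traceSpace = G₂.traceSpace :=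
    le_antisymm (traceSpace_le_of_responseGraph_le hP₁ h2T hgr.le)
      (traceSpace_le_of_responseGraph_le hP₂ h2T hgr.ge)
  have key : ∀ g ∈ separatedControls G₁.traceSpace, ‖wave K₁ P₁ g T‖ = ‖wave K₂ P₂ g T‖ := by
    intro g hg
    have hg₁ := isControl_of_mem_separatedControls hg
    obtain ⟨r, hr, hgr₁⟩ := hP₁.exists_continuous_response hg
    have hmem := hP₁.mem_responseGraph hg₁ hr hgr₁ (2 * T)
    rw [htr] at hg
    have hg₂ := isControl_of_mem_separatedControls hg
    obtain ⟨r₂, hr₂, hgr₂⟩ := hP₂.exists_continuous_response hg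
    rw [hgr] at hmem
    obtain ⟨g', u, hg', hu, h1, h2⟩ := hmem
    have hgg : Set.EqOn g g' (Set.Icc 0 (2 * T)) := Measure.eqOn_Icc_of_ae_eq volume h2T.ne
      ((coeFn_toControl _ hg₁.smooth.continuous).symm.trans h1)
      hg₁.smooth.continuous.continuousOn hg'.smooth.continuous.continuousOn
    have hrr : Set.EqOn r r₂ (Set.Icc 0 (2 * T)) := by
      refine Measure.eqOn_Icc_of_ae_eq volume h2T.ne ?_ hr.continuousOn hr₂.continuousOn
      filter_upwards [h2, coeFn_toControl (2 * T) hr, ae_restrict_mem measurableSet_Icc]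
        with t ht htr htT
      change (u t, toControl (2 * T) r t) ∈ _ at ht
      rw [htr, hP₂.eq_wave hg'.isSmoothControl hu htT.1] at ht
      refine LinearPMap.mem_graph_snd_inj _ ht (hgr₂ t htT.1) (hP₂.wave_congr hg'.isSmoothControl
        hg₂.isSmoothControl htT.1 ?_)
      exact (hgg.mono (Set.Icc_subset_Icc_right htT.2)).symm
    refine norm_wave_eq_of_response hP₁ hP₂ hT.le hg₁ hg₂ (fun t ht => hgr₁ t ht.1) fun t ht => ?_
    rw [hrr ht]
    exact hgr₂ t ht.1
  obtain ⟨F, hF, -, h2⟩ := exists_seq_separatedControls hP₁.dense_traceSpace hT.le hf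
  obtain ⟨J₁, hJ₁⟩ := exists_operator_wave (P := P₁) hP₁.nonneg hT.le
  obtain ⟨J₂, hJ₂⟩ := exists_operator_wave (P := P₂) hP₂.nonneg hT.le
  rw [← hJ₁ f hf, ← hJ₂ f hf]
  refine tendsto_nhds_unique ((J₁.continuous.norm.tendsto _).comp h2)
    (((J₂.continuous.norm.tendsto _).comp h2).congr fun n => ?_)
  have hFn := IsSmoothControl.of_mem_separatedControls (hF n)
  simp only [Function.comp_apply, hJ₁ _ hFn, hJ₂ _ hFn, key _ (hF n)]

/-! ### The graph of `L₀*` in the space of controls -/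

/-- The pairs `(S f, -S f'')` are carried by `U` to the pairs `(u^f(T), A u^f(T))`, which are
dense in the graph of `L₀*`. -/
theorem IsPoissonPair.closure_modulus_eq (hP : G.IsPoissonPair K P) (hG : G.IsRyzhov) (hT : 0 < T)
    (hc : G.IsControllable T) {S : ControlSpace B T →ₗ.[ℂ] ControlSpace B T}
    (U : S.closedRange ≃ₗᵢ[ℂ] H)
    (hU : ∀ (φ : ControlSpace B T) (y : H), (φ, y) ∈ (G.controlOperator T).closure.graph ↔
      ∃ x : S.closedRange, (φ, (x : ControlSpace B T)) ∈ S.graph ∧ U x = y) :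
    closure {p : ControlSpace B T × ControlSpace B T | ∃ (f : ℝ → B) (φ ψ : ControlSpace B T),
        G.IsControl f ∧ φ =ᵐ[volume.restrict (Set.Icc 0 T)] f ∧
        ψ =ᵐ[volume.restrict (Set.Icc 0 T)] (fun t => -deriv (deriv f) t) ∧
        (φ, p.1) ∈ S.graph ∧ (ψ, p.2) ∈ S.graph} =
      {p | ∃ x y : S.closedRange, p = ((x : ControlSpace B T), (y : ControlSpace B T)) ∧
        (U x, U y) ∈ (G.L₀†).graph} := by
  let e : H × H → ControlSpace B T × ControlSpace B T :=
    fun p => ((U.symm p.1 : ControlSpace B T), (U.symm p.2 : ControlSpace B T))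
  have he : IsClosedEmbedding e := by
    have h1 : IsClosedEmbedding fun y : H => (U.symm y : ControlSpace B T) :=
      (Submodule.isClosed_topologicalClosure _).isClosedEmbedding_subtypeVal.comp
        U.symm.toHomeomorph.isClosedEmbedding
    exact h1.prodMap h1
  have hS : ∀ {φ x y}, (φ, x) ∈ S.graph → (φ, y) ∈ (G.controlOperator T).closure.graph →
      x = U.symm y := by
    intro φ x y hx hy
    obtain ⟨x', hx', rfl⟩ := (hU φ y).1 hy
    rw [U.symm_apply_apply]
    exact LinearPMap.mem_graph_snd_inj _ hx hx' rfl
  have hS' : ∀ {φ y}, (φ, y) ∈ (G.controlOperator T).closure.graph →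
      (φ, (U.symm y : ControlSpace B T)) ∈ S.graph := by
    intro φ y hy
    obtain ⟨x', hx', rfl⟩ := (hU φ y).1 hy
    rwa [U.symm_apply_apply]
  have hneg : ∀ {f : ℝ → B}, IsSmoothControl f →
      (toControl T (fun t => -deriv (deriv f) t), -wave K P (deriv (deriv f)) T) ∈
        (G.controlOperator T).closure.graph := by
    intro f hf
    have h := hP.wave_mem_closure hT.le (hf.deriv.deriv.smul (-1))
    rw [wave_smul _ hf.deriv.deriv, neg_one_smul, neg_one_smul] at h
    exact h
  have hset : {p : ControlSpace B T × ControlSpace B T | ∃ (f : ℝ → B) (φ ψ : ControlSpace B T),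
        G.IsControl f ∧ φ =ᵐ[volume.restrict (Set.Icc 0 T)] f ∧
        ψ =ᵐ[volume.restrict (Set.Icc 0 T)] (fun t => -deriv (deriv f) t) ∧
        (φ, p.1) ∈ S.graph ∧ (ψ, p.2) ∈ S.graph} =
      e '' {p | ∃ f, G.IsControl f ∧ p = (wave K P f T, -wave K P (deriv (deriv f)) T)} := by
    ext p
    constructor
    · rintro ⟨f, φ, ψ, hf, hφ, hψ, h1, h2⟩
      have hs := hf.isSmoothControl
      rw [(eq_toControl hs.continuous).1 hφ] at h1
      rw [(eq_toControl hs.deriv.deriv.continuous.neg).1 hψ] at h2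
      exact ⟨_, ⟨f, hf, rfl⟩, Prod.ext (hS h1 (hP.wave_mem_closure hT.le hs)).symm
        (hS h2 (hneg hs)).symm⟩
    · rintro ⟨_, ⟨f, hf, rfl⟩, rfl⟩
      have hs := hf.isSmoothControl
      exact ⟨f, _, _, hf, coeFn_toControl T hs.continuous,
        coeFn_toControl T hs.deriv.deriv.continuous.neg, hS' (hP.wave_mem_closure hT.le hs),
        hS' (hneg hs)⟩
  rw [hset, he.closure_image_eq, hP.closure_wave_eq hG hT hc]
  ext p
  constructor
  · rintro ⟨q, hq, rfl⟩
    exact ⟨U.symm q.1, U.symm q.2, rfl, by simpa using hq⟩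
  · rintro ⟨x, y, rfl, h⟩
    exact ⟨(U x, U y), h, by simp [e]⟩

end GreenSystem

theorem proposition13 {H₁ H₂ B : Type*}
    [NormedAddCommGroup H₁] [InnerProductSpace ℂ H₁] [CompleteSpace H₁]
    [TopologicalSpace.SeparableSpace H₁]
    [NormedAddCommGroup H₂] [InnerProductSpace ℂ H₂] [CompleteSpace H₂]
    [TopologicalSpace.SeparableSpace H₂]
    [NormedAddCommGroup B] [InnerProductSpace ℂ B] [CompleteSpace B]
    [TopologicalSpace.SeparableSpace B]
    (G₁ : GreenSystem H₁ B) (G₂ : GreenSystem H₂ B) (hG₁ : G₁.IsRyzhov) (hG₂ : G₂.IsRyzhov)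
    (T : ℝ) (hT : 0 < T) (hc₁ : G₁.IsControllable T) (hc₂ : G₂.IsControllable T) :
    -- `|W^T|` and the polar decomposition `W^T = U |W^T|` give `L₀*` up to the unitary `U`
    (∀ S : ControlSpace B T →ₗ.[ℂ] ControlSpace B T, S.IsModulus (G₁.controlOperator T) →
      ∃ U : S.closedRange ≃ₗᵢ[ℂ] H₁,
        (∀ (φ : ControlSpace B T) (y : H₁), (φ, y) ∈ (G₁.controlOperator T).closure.graph ↔
          ∃ x : S.closedRange, (φ, (x : ControlSpace B T)) ∈ S.graph ∧ U x = y) ∧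
        closure {p : ControlSpace B T × ControlSpace B T | ∃ (f : ℝ → B) (φ ψ : ControlSpace B T),
            G₁.IsControl f ∧ φ =ᵐ[volume.restrict (Set.Icc 0 T)] f ∧
            ψ =ᵐ[volume.restrict (Set.Icc 0 T)] (fun t => -deriv (deriv f) t) ∧
            (φ, p.1) ∈ S.graph ∧ (ψ, p.2) ∈ S.graph} =
          {p | ∃ x y : S.closedRange, p = ((x : ControlSpace B T), (y : ControlSpace B T)) ∧
            (U x, U y) ∈ (G₁.L₀†).graph}) ∧
    -- `|W^T|` determines `L₀*`
    (∀ S : ControlSpace B T →ₗ.[ℂ] ControlSpace B T,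
      S.IsModulus (G₁.controlOperator T) → S.IsModulus (G₂.controlOperator T) →
      (G₁.L₀†).UnitarilyEquivalent (G₂.L₀†)) ∧
    -- `R^{2T}` determines `L₀`
    (G₁.responseOperator (2 * T) = G₂.responseOperator (2 * T) →
      G₁.L₀.UnitarilyEquivalent G₂.L₀) := by
  obtain ⟨K₁, P₁, hP₁⟩ := hG₁.exists_isPoissonPair
  obtain ⟨K₂, P₂, hP₂⟩ := hG₂.exists_isPoissonPair
  have hd₁ := hP₁.dense_domain_controlOperator hT.le
  have hd₂ := hP₂.dense_domain_controlOperator hT.le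
  have hcl₁ := hP₁.isClosable_controlOperator hT.le
  have hcl₂ := hP₂.isClosable_controlOperator hT.le
  refine ⟨fun S hS => ?_, fun S hS₁ hS₂ => ?_, fun hR => ?_⟩
  · obtain ⟨U, hU⟩ := hS.exists_polar hd₁ hcl₁ ((hP₁.dense_wave hG₁ hT hc₁).mono (by
      rintro _ ⟨f, hf, rfl⟩
      exact ⟨_, hP₁.wave_mem_closure hT.le hf.isSmoothControl⟩))
    exact ⟨U, hU, hP₁.closure_modulus_eq hG₁ hT hc₁ U hU⟩
  · exact GreenSystem.unitarilyEquivalent_of_norm_wave_eq hP₁ hP₂ hG₁ hG₂ hT hc₁ hc₂ fun f hf =>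
      hS₁.norm_eq hS₂ hd₁ hd₂ hcl₁ hcl₂ (hP₁.wave_mem_closure hT.le hf)
        (hP₂.wave_mem_closure hT.le hf)
  · exact GreenSystem.unitarilyEquivalent_L₀ hP₁ hP₂ hG₁ hG₂
      (GreenSystem.unitarilyEquivalent_of_norm_wave_eq hP₁ hP₂ hG₁ hG₂ hT hc₁ hc₂ fun f hf =>
        GreenSystem.norm_wave_eq_of_responseOperator_eq hP₁ hP₂ hT hR hf)
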